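/- \textbf{Setting.} Consider the triangular lattice with a family of horizontal lattice lines. A lozenge is the union of two unit triangles sharing an edge; for a lattice region $R$ let $M(R)$ be the number of its lozenge tilings (coverings by lozenges without gaps or overlaps) and, if $R$ is centrally symmetric, let $M_\odot(R)$ be the number of those lozenge tilings that are invariant under rotation by $180^\circ$ about the center of $R$. For non-negative integers $a_1,\dots,a_n$, the fern $F(a_1,\dots,a_n)$ is a string of $n$ lattice triangles of sizes $a_1,\dots,a_n$ (from left to right), lined up along a horizontal lattice line, touching at their vertices, and pointing alternately up and down, starting with up; its basepoint is its leftmost point. Put $o=a_1+a_3+\cdots$ and $e=a_2+a_4+\cdots$. For non-negative integers $x,y,z$ of the same parity, $FC_{x,y,z}(a_1,\dots,a_n)$ is the region obtained from the lattice hexagon of side-lengths $x+e$, $y+o$, $z+e$, $x+o$, $y+e$, $z+o$ (clockwise from top) by removing the fern $F(a_1,\dots,a_n)$ placed with its basepoint at the center of the hexagon of side-lengths $x,y,z,x,y,z$ (clockwise from top) that fits in the western corner of the large hexagon. For non-negative integers $b_1,\dots,b_l$, $s(b_1,\dots,b_l)$ is the number of lozenge tilings of the region obtained from the trapezoid of side-lengths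 $b_2+b_4+\cdots$, $b_1+b_3+\cdots$, $b_1+b_2+\cdots+b_l$, $b_1+b_3+\cdots$ (clockwise from top) by removing the leftmost $b_1$ up-pointing unit triangles along its base, keeping the next $b_2$, removing the next $b_3$, and so on. Finally $H(n):=0!\,1!\cdots(n-1)!$. \textbf{Theorem 1.} Let $x,y,z$ be even non-negative integers, let $k\ge 1$, and let $a_1,\dots,a_k$ be non-negative integers. Put $a=a_1+\cdots+a_k$ and $a_{k+i}:=a_{k-i+1}$ for $i=1,\dots,k$. Then $M_\odot(FC_{x,y,z}(a,a))$ and $M(FC_{x,y,z}(a,a))$ are positive, and $$ \frac{M_\odot(FC_{x,y,z}(a_1,\dots,a_k,a_k,\dots,a_1))}{M_\odot(FC_{x,y,z}(a,a))} =\sqrt{\frac{M(FC_{x,y,z}(a_1,\dots,a_k,a_k,\dots,a_1))}{M(FC_{x,y,z}(a,a))}} $$ $$ =s(a_1,\dots,a_k,a_k,\dots,a_1)\, \frac{H(\frac{x+z}{2}+a)}{H(\frac{x+y}{2}+a)} \prod_{1\le 2i+1\le 2k}\frac{H(\frac{x+y}{2}+a_1+\cdots+a_{2i+1})}{H(\frac{x+z}{2}+a_1+\cdots+a_{2i+1})}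 \prod_{1<2i<2k}\frac{H(\frac{x+z}{2}+a_1+\cdots+a_{2i})}{H(\frac{x+y}{2}+a_1+\cdots+a_{2i})}. $$ -/

import Mathlib

/-!
The triangular lattice: the lattice point with coordinates `(i, j)` is the point
`i • (1, 0) + j • (1/2, √3/2)` of the plane. Lattice lines have directions
`(1, 0)` (horizontal), `(0, 1)` (polar direction `π/3`) and `(-1, 1)` (polar direction `2π/3`);
they are the level lines of `j`, `i` and `i + j`, respectively.
-/

namespace FernTilings

/-- Unit triangles of the lattice: `up i j` points up and has left vertex `(i, j)`;
`down i j` points down and shares with `up i j` the edge from `(i + 1, j)` to `(i, j + 1)`. -/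
inductive UnitTriangle : Type
  | up (i j : ℤ) : UnitTriangle
  | down (i j : ℤ) : UnitTriangle

/-- The three vertices of a unit triangle. -/
def UnitTriangle.vertices : UnitTriangle → Finset (ℤ × ℤ)
  | .up i j => {(i, j), (i + 1, j), (i, j + 1)}
  | .down i j => {(i + 1, j + 1), (i, j + 1), (i + 1, j)}

/-- Two unit triangles share an edge: they are distinct and have two vertices in common. -/
def SharesEdge (u v : UnitTriangle) : Prop :=
  u ≠ v ∧ (u.vertices ∩ v.vertices).card = 2

/-- A lozenge is the union of two unit triangles that share an edge. -/
def IsLozenge (L : Set UnitTriangle) : Prop :=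
  ∃ u v, SharesEdge u v ∧ L = {u, v}

/-- A lozenge tiling of a lattice region (a set of unit triangles): a set of lozenges that cover
the region without gaps or overlaps. -/
structure IsLozengeTiling (R : Set UnitTriangle) (T : Set (Set UnitTriangle)) : Prop where
  isLozenge : ∀ L ∈ T, IsLozenge L
  disjoint : T.PairwiseDisjoint id
  cover : ⋃₀ T = R

/-- `M(R)`: the number of lozenge tilings of the region `R`. -/
noncomputable def numTilings (R : Set UnitTriangle) : ℕ :=
  {T | IsLozengeTiling R T}.ncard

/-- The rotation by 180 degrees about the point `c / 2`, that is `p ↦ c - p`, on unit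
triangles. -/
def halfTurn (c : ℤ × ℤ) : UnitTriangle → UnitTriangle
  | .up i j => .down (c.1 - i - 1) (c.2 - j - 1)
  | .down i j => .up (c.1 - i - 1) (c.2 - j - 1)

theorem vertices_halfTurn (c : ℤ × ℤ) (t : UnitTriangle) :
    (halfTurn c t).vertices = t.vertices.image (fun p => c - p) := by
  obtain ⟨c₁, c₂⟩ := c
  cases t <;> ext ⟨m, n⟩ <;>
    simp only [halfTurn, UnitTriangle.vertices, Finset.mem_insert, Finset.mem_singleton,
      Finset.mem_image, exists_eq_or_imp, exists_eq_left, Prod.mk.injEq, Prod.mk_sub_mk] <;> omega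

/-- The number of lozenge tilings of the region `R` that are invariant under the rotation by
180 degrees about the point `c / 2`. -/
noncomputable def numCentrallySymmetricTilings (c : ℤ × ℤ) (R : Set UnitTriangle) : ℕ :=
  {T | IsLozengeTiling R T ∧ (fun L => halfTurn c '' L) '' T = T}.ncard

/-- The unit triangles contained in the convex lattice polygon whose lattice points are `P`. -/
def trianglesIn (P : Set (ℤ × ℤ)) : Set UnitTriangle :=
  {t | ∀ v ∈ t.vertices, v ∈ P}

/-- The sum `a₁ + a₃ + a₅ + ⋯`. -/
def oddSum : List ℕ → ℕ
  | [] => 0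
  | [a] => a
  | a :: _ :: l => a + oddSum l

/-- The sum `a₂ + a₄ + a₆ + ⋯`. -/
def evenSum (a : List ℕ) : ℕ := oddSum a.tail

/-- The up-pointing lattice triangle of side `m` with left vertex `(p, q)`. -/
def upLobe (m : ℕ) (p q : ℤ) : Set UnitTriangle :=
  trianglesIn {v | p ≤ v.1 ∧ q ≤ v.2 ∧ v.1 + v.2 ≤ p + q + m}

/-- The down-pointing lattice triangle of side `m` with left vertex `(p, q)`. -/
def downLobe (m : ℕ) (p q : ℤ) : Set UnitTriangle :=
  trianglesIn {v | v.1 ≤ p + m ∧ v.2 ≤ q ∧ p + q ≤ v.1 + v.2}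

/-- A string of lattice triangles of the given sizes, lined up from left to right along the
horizontal lattice line through `(p, q)`, starting at `(p, q)`, touching at their vertices and
alternately pointing up and down; the first one points up if and only if the Boolean is
`true`. -/
def lobes : Bool → List ℕ → ℤ → ℤ → Set UnitTriangle
  | _, [], _, _ => ∅
  | true, m :: l, p, q => upLobe m p q ∪ lobes false l (p + m) q
  | false, m :: l, p, q => downLobe m p q ∪ lobes true l (p + m) q

/-- The fern `F(a₁, …, a_k)` with basepoint `(p, q)`. -/
def fern (a : List ℕ) (p q : ℤ) : Set UnitTriangle := lobes true a p q

/-- The hexagon of side-lengths `x + e`, `y + o`, `z + e`, `x + o`, `y + e`, `z + o` (clockwise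
from top), with its western vertex at the origin. Clockwise from there, its vertices are `(0, 0)`,
`(0, z + o)`, `(x + e, z + o)`, `(x + y + o + e, z - y)`, `(x + y + o + e, -(y + e))` and
`(y + e, -(y + e))`. -/
def hexagon (x y z o e : ℕ) : Set UnitTriangle :=
  trianglesIn {v | 0 ≤ v.1 ∧ v.1 ≤ (x + y + o + e : ℤ) ∧
    -(y + e : ℤ) ≤ v.2 ∧ v.2 ≤ (z + o : ℤ) ∧
    0 ≤ v.1 + v.2 ∧ v.1 + v.2 ≤ (x + z + o + e : ℤ)}

/-- The fern-cored hexagon `FC_{x,y,z}(a₁, …, a_k)`, for `x`, `y`, `z` of the same parity. The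
basepoint of the fern is at `((x + y) / 2, (z - y) / 2)`, the center of the auxiliary hexagon of
side-lengths `x`, `y`, `z`, `x`, `y`, `z` in the western corner of the outer hexagon. -/
def fernCoredHexagon (x y z : ℕ) (a : List ℕ) : Set UnitTriangle :=
  hexagon x y z (oddSum a) (evenSum a) \ fern a (((x : ℤ) + y) / 2) (((z : ℤ) - y) / 2)

/-- Twice the midpoint of the western and the eastern vertex of the outer hexagon of
`FC_{x,y,z}(a₁, …, a_k)`; this midpoint is the center of the outer hexagon if
`a₁ + a₃ + ⋯ = a₂ + a₄ + ⋯`. -/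
def doubledCenter (x y z : ℕ) (a : List ℕ) : ℤ × ℤ :=
  ((x : ℤ) + y + a.sum, (z : ℤ) - y)

/-- `M_⊙(FC_{x,y,z}(a₁, …, a_k))`, for `a₁ + a₃ + ⋯ = a₂ + a₄ + ⋯`. -/
noncomputable def numCentrallySymmetricTilingsFC (x y z : ℕ) (a : List ℕ) : ℕ :=
  numCentrallySymmetricTilings (doubledCenter x y z a) (fernCoredHexagon x y z a)

/-- The up-pointing unit triangles on the horizontal line through the origin that sit on the
first, third, … (Boolean `true`) or second, fourth, … (Boolean `false`) of consecutive segments of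
the given lengths starting at `(p, 0)`. -/
def dents : Bool → List ℕ → ℤ → Set UnitTriangle
  | _, [], _ => ∅
  | true, m :: l, p => {t | ∃ i : ℤ, p ≤ i ∧ i < p + m ∧ t = .up i 0} ∪ dents false l (p + m)
  | false, m :: l, p => dents true l (p + m)

/-- The dented semihexagon `S(b₁, …, b_l)`: the trapezoid of side-lengths `b₂ + b₄ + ⋯`,
`b₁ + b₃ + ⋯`, `b₁ + b₂ + ⋯ + b_l`, `b₁ + b₃ + ⋯` (clockwise from top), from whose base the
leftmost `b₁` up-pointing unit triangles are removed, the next `b₂` are kept, the next `b₃` are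
removed, and so on. -/
def semihexagon (b : List ℕ) : Set UnitTriangle :=
  trianglesIn {v | 0 ≤ v.1 ∧ 0 ≤ v.2 ∧ v.2 ≤ (oddSum b : ℤ) ∧ v.1 + v.2 ≤ (b.sum : ℤ)}
    \ dents true b 0

/-- `s(b₁, …, b_l)`: the number of lozenge tilings of `S(b₁, …, b_l)`. -/
noncomputable def s (b : List ℕ) : ℕ := numTilings (semihexagon b)

/-- The hyperfactorial `H(n) = 0! 1! ⋯ (n - 1)!`. -/
def hyperfactorial (n : ℕ) : ℕ := ∏ i ∈ Finset.range n, i.factorial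

/-- The partial sum `a₁ + ⋯ + a_j`. -/
def partialSum (a : List ℕ) (j : ℕ) : ℕ := (a.take j).sum

end FernTilings

open FernTilings

/-! Cut the region along the horizontal axis through its center. A tiling amounts to the set S of
positions at which lozenges cross the axis, together with tilings of the two halves. The half-turn
carries the lower half with crossings S to the upper half with the reflected crossings σS. So M is a
sum over S of products of two upper-half counts, at S and at σS, while M_⊙ is a sum over the S with
σS = S of a single upper-half count (`numTilings_eq_sum`, `numTilings_below`,
`numCentrallySymmetricTilings_eq_sum`).

The upper half is a trapezoid with triangles removed along its base: the up-pointing lobes of the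
fern, a corner lying outside the hexagon, and the unit triangles at S. A removed lobe may be
replaced by a run of unit dents, because such a run forces all lozenges in the triangle above it.
The Cohn–Larsen–Propp formula (`numTilings_trapezoid`) then gives V(S ∪ E ∪ F) divided by a
hyperfactorial, where V is the Vandermonde product, E the corner dents and F the fern dents. With d
denoting the product of distances between two sets, this factors as V(S ∪ E ∪ F) = w(F) · V(S ∪ E) ·
d(S, F), where w(F) = V(F) d(E, F) (`vand_dents`).

The decisive point is the palindromic shape of the fern: σ maps F onto its complement in the
interval I covered by the fern. Hence d(S, F) d(σS, F) = d(S, I), which depends on the fern only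
through its length (`distProd_fernDents`). So M is w(F)² times a sum that ignores the shape of the
fern. If S = σS then d(S, F) = √d(S, I), so M_⊙ is w(F) times another such sum. Dividing by the
counts for the fern (a, a) cancels the sums and leaves the square of a ratio of weights,
respectively that ratio itself.

The ratio of weights is explicit (`fernWeight_div`): V(F) counts the tilings of the dented
semihexagon, by the same formula, and d(E, F) is, up to a constant, a product over F of quotients of
factorials, which telescopes along each lobe to quotients of hyperfactorials. -/

namespace FernTilings

open UnitTriangle

/-! ### The three kinds of lozenges, and general facts on tilings -/

/-- The height of the lattice line that carries the lower side of the strip of a triangle. -/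
def UnitTriangle.row : UnitTriangle → ℤ
  | .up _ j => j
  | .down _ j => j

/-- The lozenge made of an up-pointing triangle and its right neighbour. -/
def lozR (i j : ℤ) : Set UnitTriangle := {up i j, down i j}

/-- The lozenge made of a down-pointing triangle and its right neighbour. -/
def lozL (i j : ℤ) : Set UnitTriangle := {down i j, up (i + 1) j}

/-- The lozenge that crosses the horizontal line at height `j`. -/
def lozV (i j : ℤ) : Set UnitTriangle := {down i (j - 1), up i j}

theorem not_sharesEdge_up_up (i j k l : ℤ) : ¬ SharesEdge (up i j) (up k l) := by
  rintro ⟨hne, hc⟩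
  have hne' : ¬ (i = k ∧ j = l) := by
    rintro ⟨rfl, rfl⟩; exact hne rfl
  have : ((up i j).vertices ∩ (up k l).vertices).card ≤ 1 := by
    refine Finset.card_le_one.2 ?_
    rintro ⟨a, b⟩ h1 ⟨c, d⟩ h2
    simp only [UnitTriangle.vertices, Finset.mem_inter, Finset.mem_insert, Finset.mem_singleton,
      Prod.mk.injEq] at h1 h2 ⊢
    omega
  omega

theorem not_sharesEdge_down_down (i j k l : ℤ) : ¬ SharesEdge (down i j) (down k l) := by
  rintro ⟨hne, hc⟩
  have hne' : ¬ (i = k ∧ j = l) := by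
    rintro ⟨rfl, rfl⟩; exact hne rfl
  have : ((down i j).vertices ∩ (down k l).vertices).card ≤ 1 := by
    refine Finset.card_le_one.2 ?_
    rintro ⟨a, b⟩ h1 ⟨c, d⟩ h2
    simp only [UnitTriangle.vertices, Finset.mem_inter, Finset.mem_insert, Finset.mem_singleton,
      Prod.mk.injEq] at h1 h2 ⊢
    omega
  omega

theorem sharesEdge_comm {u v : UnitTriangle} : SharesEdge u v ↔ SharesEdge v u := by
  unfold SharesEdge; rw [Finset.inter_comm, ne_comm]

theorem sharesEdge_up_down (i j k l : ℤ) : SharesEdge (up i j) (down k l) ↔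
    (k = i ∧ l = j) ∨ (k + 1 = i ∧ l = j) ∨ (k = i ∧ l + 1 = j) := by
  constructor
  · rintro ⟨-, hc⟩
    by_contra hcon
    have : ((up i j).vertices ∩ (down k l).vertices).card ≤ 1 := by
      refine Finset.card_le_one.2 ?_
      rintro ⟨a, b⟩ h1 ⟨c, d⟩ h2
      simp only [UnitTriangle.vertices, Finset.mem_inter, Finset.mem_insert, Finset.mem_singleton,
        Prod.mk.injEq] at h1 h2 ⊢
      omega
    omega
  · intro h
    refine ⟨by simp, ?_⟩
    rw [Finset.card_eq_two]
    rcases h with ⟨rfl, rfl⟩ | ⟨rfl, rfl⟩ | ⟨rfl, rfl⟩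
    · refine ⟨(k + 1, l), (k, l + 1), by simp, ?_⟩
      ext ⟨a, b⟩
      simp only [UnitTriangle.vertices, Finset.mem_inter, Finset.mem_insert, Finset.mem_singleton,
        Prod.mk.injEq]
      omega
    · refine ⟨(k + 1, l), (k + 1, l + 1), by simp, ?_⟩
      ext ⟨a, b⟩
      simp only [UnitTriangle.vertices, Finset.mem_inter, Finset.mem_insert, Finset.mem_singleton,
        Prod.mk.injEq]
      omega
    · refine ⟨(k, l + 1), (k + 1, l + 1), by simp, ?_⟩
      ext ⟨a, b⟩
      simp only [UnitTriangle.vertices, Finset.mem_inter, Finset.mem_insert, Finset.mem_singleton,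
        Prod.mk.injEq]
      omega

theorem isLozenge_lozR (i j : ℤ) : IsLozenge (lozR i j) :=
  ⟨_, _, (sharesEdge_up_down i j i j).2 (by simp), rfl⟩

theorem isLozenge_lozL (i j : ℤ) : IsLozenge (lozL i j) :=
  ⟨_, _, sharesEdge_comm.1 ((sharesEdge_up_down (i + 1) j i j).2 (by simp)), rfl⟩

theorem isLozenge_lozV (i j : ℤ) : IsLozenge (lozV i j) :=
  ⟨_, _, sharesEdge_comm.1 ((sharesEdge_up_down i j i (j - 1)).2 (by simp)), rfl⟩

theorem IsLozenge.cases {L : Set UnitTriangle} (h : IsLozenge L) :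
    ∃ i j, L = lozR i j ∨ L = lozL i j ∨ L = lozV i j := by
  have key : ∀ i j k l, SharesEdge (up i j) (down k l) →
      ∃ m n, ({up i j, down k l} : Set UnitTriangle) = lozR m n ∨
        ({up i j, down k l} : Set UnitTriangle) = lozL m n ∨
        ({up i j, down k l} : Set UnitTriangle) = lozV m n := by
    intro i j k l h
    rcases (sharesEdge_up_down i j k l).1 h with ⟨rfl, rfl⟩ | ⟨rfl, rfl⟩ | ⟨rfl, rfl⟩
    · exact ⟨k, l, .inl rfl⟩
    · exact ⟨k, l, .inr (.inl (Set.pair_comm _ _))⟩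
    · refine ⟨k, l + 1, .inr (.inr ?_)⟩
      rw [lozV, Set.pair_comm, add_sub_cancel_right]
  obtain ⟨u, v, h, rfl⟩ := h
  rcases u with ⟨i, j⟩ | ⟨i, j⟩ <;> rcases v with ⟨k, l⟩ | ⟨k, l⟩
  · exact absurd h (not_sharesEdge_up_up _ _ _ _)
  · exact key _ _ _ _ h
  · rw [Set.pair_comm]
    exact key _ _ _ _ (sharesEdge_comm.1 h)
  · exact absurd h (not_sharesEdge_down_down _ _ _ _)

theorem IsLozenge.nonempty {L : Set UnitTriangle} (h : IsLozenge L) : L.Nonempty := by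
  obtain ⟨u, v, -, rfl⟩ := h
  exact ⟨u, by simp⟩

theorem IsLozenge.eq_of_up_mem {L : Set UnitTriangle} (h : IsLozenge L) {i j : ℤ}
    (hm : up i j ∈ L) : L = lozR i j ∨ L = lozL (i - 1) j ∨ L = lozV i j := by
  obtain ⟨k, l, rfl | rfl | rfl⟩ := h.cases <;>
    simp only [lozR, lozL, lozV, Set.mem_insert_iff, Set.mem_singleton_iff, reduceCtorEq, or_false,
      false_or, up.injEq] at hm <;> obtain ⟨rfl, rfl⟩ := hm
  · exact .inl rfl
  · right; left; simp
  · right; right; rfl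

theorem IsLozenge.eq_of_down_mem {L : Set UnitTriangle} (h : IsLozenge L) {i j : ℤ}
    (hm : down i j ∈ L) : L = lozR i j ∨ L = lozL i j ∨ L = lozV i (j + 1) := by
  obtain ⟨k, l, rfl | rfl | rfl⟩ := h.cases <;>
    simp only [lozR, lozL, lozV, Set.mem_insert_iff, Set.mem_singleton_iff, reduceCtorEq, or_false,
      false_or, down.injEq] at hm <;> obtain ⟨rfl, rfl⟩ := hm
  · exact .inl rfl
  · exact .inr (.inl rfl)
  · right; right; simp

namespace IsLozengeTiling

variable {R R' : Set UnitTriangle} {T T' : Set (Set UnitTriangle)}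

theorem subset (h : IsLozengeTiling R T) {L : Set UnitTriangle} (hL : L ∈ T) : L ⊆ R := by
  rw [← h.cover]; exact Set.subset_sUnion_of_mem hL

theorem exists_mem (h : IsLozengeTiling R T) {t : UnitTriangle} (ht : t ∈ R) :
    ∃ L ∈ T, t ∈ L := by
  rw [← h.cover] at ht; exact ht

theorem eq_of_mem (h : IsLozengeTiling R T) {L L' : Set UnitTriangle} (hL : L ∈ T) (hL' : L' ∈ T)
    {t : UnitTriangle} (ht : t ∈ L) (ht' : t ∈ L') : L = L' :=
  h.disjoint.elim hL hL' (Set.not_disjoint_iff.2 ⟨t, ht, ht'⟩)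

theorem mono (h : IsLozengeTiling R T) (hT : T' ⊆ T) : IsLozengeTiling (⋃₀ T') T' :=
  ⟨fun L hL => h.isLozenge L (hT hL), h.disjoint.subset hT, rfl⟩

theorem union (h : IsLozengeTiling R T) (h' : IsLozengeTiling R' T') (hd : Disjoint R R') :
    IsLozengeTiling (R ∪ R') (T ∪ T') := by
  refine ⟨?_, ?_, ?_⟩
  · rintro L (hL | hL)
    · exact h.isLozenge L hL
    · exact h'.isLozenge L hL
  · refine Set.pairwiseDisjoint_union.2 ⟨h.disjoint, h'.disjoint, fun L hL L' hL' _ => ?_⟩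
    exact hd.mono (h.subset hL) (h'.subset hL')
  · rw [Set.sUnion_union, h.cover, h'.cover]

theorem sUnion_diff (h : IsLozengeTiling R T) (hT : T' ⊆ T) :
    ⋃₀ (T \ T') = R \ ⋃₀ T' := by
  ext t
  constructor
  · rintro ⟨L, ⟨hL, hL'⟩, ht⟩
    refine ⟨h.subset hL ht, ?_⟩
    rintro ⟨L₂, hL₂, ht₂⟩
    exact hL' (h.eq_of_mem hL (hT hL₂) ht ht₂ ▸ hL₂)
  · rintro ⟨ht, ht'⟩
    obtain ⟨L, hL, htL⟩ := h.exists_mem ht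
    exact ⟨L, ⟨hL, fun hL' => ht' ⟨L, hL', htL⟩⟩, htL⟩

end IsLozengeTiling

theorem finite_tilings {R : Set UnitTriangle} (hR : R.Finite) :
    {T | IsLozengeTiling R T}.Finite := by
  refine (hR.finite_subsets.finite_subsets).subset ?_
  intro T hT L hL
  exact hT.subset hL

/-- Lozenges that occur in every tiling may be removed. -/
theorem numTilings_diff_sUnion {R : Set UnitTriangle} {F : Set (Set UnitTriangle)}
    (hF : IsLozengeTiling (⋃₀ F) F) (hsub : ⋃₀ F ⊆ R)
    (h : ∀ T, IsLozengeTiling R T → F ⊆ T) :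
    numTilings (R \ ⋃₀ F) = numTilings R := by
  unfold numTilings
  symm
  have himg : {T | IsLozengeTiling R T} = (fun T => T ∪ F) '' {T | IsLozengeTiling (R \ ⋃₀ F) T} := by
    ext T
    constructor
    · intro hT
      refine ⟨T \ F, ?_, Set.sdiff_union_of_subset (h T hT)⟩
      have := hT.mono (T' := T \ F) Set.sdiff_subset
      rwa [hT.sUnion_diff (h T hT)] at this
    · rintro ⟨T, hT, rfl⟩
      have := IsLozengeTiling.union hT hF Set.disjoint_sdiff_left
      rwa [Set.sdiff_union_of_subset hsub] at this
  rw [himg, Set.InjOn.ncard_image]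
  have hdis : ∀ T, IsLozengeTiling (R \ ⋃₀ F) T → Disjoint T F := by
    intro T hT
    refine Set.disjoint_left.2 fun L hL hLF => ?_
    obtain ⟨t, ht⟩ := (hT.isLozenge L hL).nonempty
    exact (hT.subset hL ht).2 ⟨L, hLF, ht⟩
  intro T hT T' hT' heq
  have := congrArg (fun A => A \ F) heq
  simpa only [Set.union_sdiff_right, (hdis T hT).sdiff_eq_left, (hdis T' hT').sdiff_eq_left] using this

/-! ### The half-turn acting on tilings -/

theorem halfTurn_halfTurn (c : ℤ × ℤ) (t : UnitTriangle) : halfTurn c (halfTurn c t) = t := by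
  cases t <;> simp only [halfTurn, up.injEq, down.injEq] <;> constructor <;> ring

theorem halfTurn_involutive (c : ℤ × ℤ) : Function.Involutive (halfTurn c) := halfTurn_halfTurn c

theorem mem_image_halfTurn {c : ℤ × ℤ} {R : Set UnitTriangle} {t : UnitTriangle} :
    t ∈ halfTurn c '' R ↔ halfTurn c t ∈ R := by
  rw [Set.image_eq_preimage_of_inverse (halfTurn_involutive c) (halfTurn_involutive c)]; rfl

theorem image_image_halfTurn (c : ℤ × ℤ) (R : Set UnitTriangle) :
    halfTurn c '' (halfTurn c '' R) = R := by
  ext t; simp only [mem_image_halfTurn, halfTurn_halfTurn]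

theorem image_image_image_halfTurn (c : ℤ × ℤ) (T : Set (Set UnitTriangle)) :
    (fun L => halfTurn c '' L) '' ((fun L => halfTurn c '' L) '' T) = T := by
  rw [Set.image_image]
  simp only [image_image_halfTurn, Set.image_id']

theorem SharesEdge.halfTurn {u v : UnitTriangle} (h : SharesEdge u v) (c : ℤ × ℤ) :
    SharesEdge (halfTurn c u) (halfTurn c v) := by
  refine ⟨fun he => h.1 ((halfTurn_involutive c).injective he), ?_⟩
  rw [vertices_halfTurn, vertices_halfTurn, ← Finset.image_inter _ _ (sub_right_injective),
    Finset.card_image_of_injective _ (sub_right_injective), h.2]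

theorem IsLozengeTiling.image_halfTurn {R : Set UnitTriangle} {T : Set (Set UnitTriangle)}
    (h : IsLozengeTiling R T) (c : ℤ × ℤ) :
    IsLozengeTiling (halfTurn c '' R) ((fun L => halfTurn c '' L) '' T) := by
  refine ⟨?_, ?_, ?_⟩
  · rintro _ ⟨L, hL, rfl⟩
    obtain ⟨u, v, huv, rfl⟩ := h.isLozenge L hL
    exact ⟨_, _, huv.halfTurn c, Set.image_pair _ _ _⟩
  · rintro _ ⟨L, hL, rfl⟩ _ ⟨L', hL', rfl⟩ hne
    exact (Set.disjoint_image_iff (halfTurn_involutive c).injective).2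
      (h.disjoint hL hL' fun he => hne (by rw [he]))
  · rw [← h.cover, Set.sUnion_image, Set.sUnion_eq_biUnion, Set.image_iUnion₂]

theorem numTilings_image_halfTurn (c : ℤ × ℤ) (R : Set UnitTriangle) :
    numTilings (halfTurn c '' R) = numTilings R := by
  unfold numTilings
  have : {T | IsLozengeTiling (halfTurn c '' R) T} =
      (fun T => (fun L => halfTurn c '' L) '' T) '' {T | IsLozengeTiling R T} := by
    ext T
    constructor
    · intro h
      refine ⟨_, ?_, image_image_image_halfTurn c T⟩
      have := IsLozengeTiling.image_halfTurn h c
      rwa [image_image_halfTurn] at this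
    · rintro ⟨T, hT, rfl⟩
      exact IsLozengeTiling.image_halfTurn hT c
  rw [this, Set.ncard_image_of_injective]
  exact (show Function.Involutive _ from image_image_image_halfTurn c).injective

/-! ### Cutting a region along a horizontal line -/

/-- The up-pointing triangles of the strip at height `q` with positions in `S`. -/
def ups (S : Set ℤ) (q : ℤ) : Set UnitTriangle := (fun i => up i q) '' S

/-- The down-pointing triangles of the strip at height `q` with positions in `S`. -/
def downs (S : Set ℤ) (q : ℤ) : Set UnitTriangle := (fun i => down i q) '' S

/-- The lozenges that cross the horizontal line at height `q` at the positions in `S`. -/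
def crossings (S : Set ℤ) (q : ℤ) : Set (Set UnitTriangle) := (fun i => lozV i q) '' S

/-- The part of a region above the line at height `q`. -/
def above (R : Set UnitTriangle) (q : ℤ) : Set UnitTriangle := {t ∈ R | q ≤ t.row}

/-- The part of a region below the line at height `q`. -/
def below (R : Set UnitTriangle) (q : ℤ) : Set UnitTriangle := {t ∈ R | t.row < q}

@[simp] theorem up_mem_ups {S : Set ℤ} {q i j : ℤ} : up i j ∈ ups S q ↔ i ∈ S ∧ j = q := by
  simp only [ups, Set.mem_image, up.injEq]
  constructor
  · rintro ⟨k, hk, rfl, rfl⟩; exact ⟨hk, rfl⟩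
  · rintro ⟨hi, rfl⟩; exact ⟨i, hi, rfl, rfl⟩

@[simp] theorem down_not_mem_ups {S : Set ℤ} {q i j : ℤ} : down i j ∉ ups S q := by
  simp [ups]

@[simp] theorem down_mem_downs {S : Set ℤ} {q i j : ℤ} : down i j ∈ downs S q ↔ i ∈ S ∧ j = q := by
  simp only [downs, Set.mem_image, down.injEq]
  constructor
  · rintro ⟨k, hk, rfl, rfl⟩; exact ⟨hk, rfl⟩
  · rintro ⟨hi, rfl⟩; exact ⟨i, hi, rfl, rfl⟩

@[simp] theorem up_not_mem_downs {S : Set ℤ} {q i j : ℤ} : up i j ∉ downs S q := by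
  simp [downs]

theorem lozV_injective (q : ℤ) : Function.Injective (fun i => lozV i q) := by
  intro i k h
  have : up i q ∈ lozV k q := by rw [← show lozV i q = lozV k q from h]; simp [lozV]
  simpa [lozV] using this

theorem isLozengeTiling_crossings (S : Set ℤ) (q : ℤ) :
    IsLozengeTiling (ups S q ∪ downs S (q - 1)) (crossings S q) := by
  refine ⟨?_, ?_, ?_⟩
  · rintro _ ⟨i, -, rfl⟩; exact isLozenge_lozV i q
  · rintro _ ⟨i, -, rfl⟩ _ ⟨k, -, rfl⟩ hne
    refine Set.disjoint_left.2 fun t ht ht' => hne ?_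
    simp only [id, lozV, Set.mem_insert_iff, Set.mem_singleton_iff] at ht ht'
    have : i = k := by
      rcases ht with rfl | rfl
      · simpa using ht'
      · simpa using ht'
    rw [this]
  · ext t
    simp only [crossings, Set.sUnion_image, Set.mem_iUnion, lozV, ups, downs]
    constructor
    · rintro ⟨i, hi, rfl | rfl⟩
      · exact .inr ⟨i, hi, rfl⟩
      · exact .inl ⟨i, hi, rfl⟩
    · rintro (⟨i, hi, rfl⟩ | ⟨i, hi, rfl⟩)
      · exact ⟨i, hi, .inr rfl⟩
      · exact ⟨i, hi, .inl rfl⟩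

theorem IsLozenge.above_or_below_or {L : Set UnitTriangle} (h : IsLozenge L) (q : ℤ) :
    (∀ t ∈ L, q ≤ t.row) ∨ (∀ t ∈ L, t.row < q) ∨ ∃ i, L = lozV i q := by
  obtain ⟨i, j, rfl | rfl | rfl⟩ := h.cases
  · simp only [lozR, Set.mem_insert_iff, Set.mem_singleton_iff, forall_eq_or_imp, forall_eq, row]
    omega
  · simp only [lozL, Set.mem_insert_iff, Set.mem_singleton_iff, forall_eq_or_imp, forall_eq, row]
    omega
  · rcases eq_or_ne j q with rfl | hne
    · exact .inr (.inr ⟨i, rfl⟩)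
    · simp only [lozV, Set.mem_insert_iff, Set.mem_singleton_iff, forall_eq_or_imp, forall_eq, row]
      omega

/-- The lozenges of `T` above the line at height `q`. -/
def lozAbove (T : Set (Set UnitTriangle)) (q : ℤ) : Set (Set UnitTriangle) :=
  {L ∈ T | ∀ t ∈ L, q ≤ t.row}

/-- The lozenges of `T` below the line at height `q`. -/
def lozBelow (T : Set (Set UnitTriangle)) (q : ℤ) : Set (Set UnitTriangle) :=
  {L ∈ T | ∀ t ∈ L, t.row < q}

theorem not_lozV_above (i q : ℤ) : ¬ ∀ t ∈ lozV i q, q ≤ t.row := by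
  simp [lozV, row]

theorem not_lozV_below (i q : ℤ) : ¬ ∀ t ∈ lozV i q, t.row < q := by
  simp [lozV, row]

section cut

variable {R : Set UnitTriangle} {T : Set (Set UnitTriangle)} {S : Set ℤ} {q : ℤ}

theorem IsLozengeTiling.eq_union (h : IsLozengeTiling R T) (hS : ∀ i, i ∈ S ↔ lozV i q ∈ T) :
    T = lozAbove T q ∪ lozBelow T q ∪ crossings S q := by
  ext L
  constructor
  · intro hL
    rcases (h.isLozenge L hL).above_or_below_or q with h1 | h1 | ⟨i, rfl⟩
    · exact .inl (.inl ⟨hL, h1⟩)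
    · exact .inl (.inr ⟨hL, h1⟩)
    · exact .inr ⟨i, (hS i).2 hL, rfl⟩
  · rintro ((hL | hL) | ⟨i, hi, rfl⟩)
    · exact hL.1
    · exact hL.1
    · exact (hS i).1 hi

theorem IsLozengeTiling.above (h : IsLozengeTiling R T) (hS : ∀ i, i ∈ S ↔ lozV i q ∈ T) :
    IsLozengeTiling (above R q \ ups S q) (lozAbove T q) := by
  have h1 := h.mono (T' := lozAbove T q) (fun L hL => hL.1)
  convert h1 using 1
  ext t
  constructor
  · rintro ⟨⟨ht, hr⟩, hu⟩
    obtain ⟨L, hL, htL⟩ := h.exists_mem ht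
    rcases (h.isLozenge L hL).above_or_below_or q with h1 | h1 | ⟨i, rfl⟩
    · exact ⟨L, ⟨hL, h1⟩, htL⟩
    · exact absurd (h1 t htL) (by omega)
    · rcases htL with rfl | rfl
      · simp only [row] at hr; omega
      · exact absurd ⟨i, (hS i).2 hL, rfl⟩ hu
  · rintro ⟨L, ⟨hL, hr⟩, ht⟩
    refine ⟨⟨h.subset hL ht, hr t ht⟩, ?_⟩
    rintro ⟨i, hi, rfl⟩
    have := h.eq_of_mem hL ((hS i).1 hi) ht (by simp [lozV])
    subst this
    exact not_lozV_above _ _ hr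

theorem IsLozengeTiling.below (h : IsLozengeTiling R T) (hS : ∀ i, i ∈ S ↔ lozV i q ∈ T) :
    IsLozengeTiling (below R q \ downs S (q - 1)) (lozBelow T q) := by
  have h1 := h.mono (T' := lozBelow T q) (fun L hL => hL.1)
  convert h1 using 1
  ext t
  constructor
  · rintro ⟨⟨ht, hr⟩, hu⟩
    obtain ⟨L, hL, htL⟩ := h.exists_mem ht
    rcases (h.isLozenge L hL).above_or_below_or q with h1 | h1 | ⟨i, rfl⟩
    · exact absurd (h1 t htL) (by omega)
    · exact ⟨L, ⟨hL, h1⟩, htL⟩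
    · rcases htL with rfl | rfl
      · exact absurd ⟨i, (hS i).2 hL, rfl⟩ hu
      · simp only [row] at hr; omega
  · rintro ⟨L, ⟨hL, hr⟩, ht⟩
    refine ⟨⟨h.subset hL ht, hr t ht⟩, ?_⟩
    rintro ⟨i, hi, rfl⟩
    have := h.eq_of_mem hL ((hS i).1 hi) ht (by simp [lozV])
    subst this
    exact not_lozV_below _ _ hr

variable {X Y : Set (Set UnitTriangle)}

theorem IsLozengeTiling.glue (hX : IsLozengeTiling (FernTilings.above R q \ ups S q) X)
    (hY : IsLozengeTiling (FernTilings.below R q \ downs S (q - 1)) Y)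
    (hS : ∀ i ∈ S, up i q ∈ R ∧ down i (q - 1) ∈ R) :
    IsLozengeTiling R (X ∪ Y ∪ crossings S q) := by
  have h1 : Disjoint (FernTilings.above R q \ ups S q)
      (FernTilings.below R q \ downs S (q - 1)) := by
    refine Set.disjoint_left.2 fun t ht ht' => ?_
    have := ht.1.2
    have := ht'.1.2
    omega
  have h2 : Disjoint (FernTilings.above R q \ ups S q ∪ FernTilings.below R q \ downs S (q - 1))
      (ups S q ∪ downs S (q - 1)) := by
    refine Set.disjoint_left.2 fun t ht ht' => ?_
    rcases ht with ht | ht <;> rcases ht' with ht' | ht'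
    · exact ht.2 ht'
    · obtain ⟨i, hi, rfl⟩ := ht'
      have := ht.1.2
      simp only [row] at this; omega
    · obtain ⟨i, hi, rfl⟩ := ht'
      have := ht.1.2
      simp only [row] at this; omega
    · exact ht.2 ht'
  have := (hX.union hY h1).union (isLozengeTiling_crossings S q) h2
  convert this using 1
  ext t
  constructor
  · intro ht
    by_cases hu : t ∈ ups S q ∪ downs S (q - 1)
    · exact .inr hu
    · left
      rcases le_or_gt q t.row with h | h
      · exact .inl ⟨⟨ht, h⟩, fun hh => hu (.inl hh)⟩
      · exact .inr ⟨⟨ht, h⟩, fun hh => hu (.inr hh)⟩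
  · rintro ((ht | ht) | (⟨i, hi, rfl⟩ | ⟨i, hi, rfl⟩))
    · exact ht.1.1
    · exact ht.1.1
    · exact (hS i hi).1
    · exact (hS i hi).2

theorem row_of_above (hX : IsLozengeTiling (above R q \ ups S q) X) {L : Set UnitTriangle}
    (hL : L ∈ X) : ∀ t ∈ L, q ≤ t.row := fun _ ht => (hX.subset hL ht).1.2

theorem row_of_below (hY : IsLozengeTiling (below R q \ downs S (q - 1)) Y) {L : Set UnitTriangle}
    (hL : L ∈ Y) : ∀ t ∈ L, t.row < q := fun _ ht => (hY.subset hL ht).1.2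

theorem not_above_and_below {L : Set UnitTriangle} (hL : IsLozenge L)
    (h : ∀ t ∈ L, q ≤ t.row) (h' : ∀ t ∈ L, t.row < q) : False := by
  obtain ⟨t, ht⟩ := hL.nonempty
  have := h t ht
  have := h' t ht
  omega

theorem lozAbove_glue (hX : IsLozengeTiling (above R q \ ups S q) X)
    (hY : IsLozengeTiling (below R q \ downs S (q - 1)) Y) :
    lozAbove (X ∪ Y ∪ crossings S q) q = X := by
  ext L
  constructor
  · rintro ⟨(hL | hL) | ⟨i, -, rfl⟩, hr⟩
    · exact hL
    · exact (not_above_and_below (hY.isLozenge L hL) hr (row_of_below hY hL)).elim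
    · exact (not_lozV_above _ _ hr).elim
  · exact fun hL => ⟨.inl (.inl hL), row_of_above hX hL⟩

theorem lozBelow_glue (hX : IsLozengeTiling (above R q \ ups S q) X)
    (hY : IsLozengeTiling (below R q \ downs S (q - 1)) Y) :
    lozBelow (X ∪ Y ∪ crossings S q) q = Y := by
  ext L
  constructor
  · rintro ⟨(hL | hL) | ⟨i, -, rfl⟩, hr⟩
    · exact (not_above_and_below (hX.isLozenge L hL) (row_of_above hX hL) hr).elim
    · exact hL
    · exact (not_lozV_below _ _ hr).elim
  · exact fun hL => ⟨.inl (.inr hL), row_of_below hY hL⟩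

theorem lozV_mem_glue (hX : IsLozengeTiling (above R q \ ups S q) X)
    (hY : IsLozengeTiling (below R q \ downs S (q - 1)) Y) (i : ℤ) :
    i ∈ S ↔ lozV i q ∈ X ∪ Y ∪ crossings S q := by
  constructor
  · exact fun hi => .inr ⟨i, hi, rfl⟩
  · rintro ((hL | hL) | ⟨k, hk, he⟩)
    · exact (not_lozV_above _ _ (row_of_above hX hL)).elim
    · exact (not_lozV_below _ _ (row_of_below hY hL)).elim
    · rwa [← lozV_injective q he]

/-- Once the crossing lozenges are prescribed, every other lozenge lies on one side of the line, so
the two sides are tiled independently; `glue` inverts the splitting. -/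
theorem ncard_tilings_of_crossings (hS : ∀ i ∈ S, up i q ∈ R ∧ down i (q - 1) ∈ R) :
    {T | IsLozengeTiling R T ∧ ∀ i, i ∈ S ↔ lozV i q ∈ T}.ncard =
      numTilings (above R q \ ups S q) * numTilings (below R q \ downs S (q - 1)) := by
  unfold numTilings
  rw [← Set.ncard_prod]
  symm
  refine Set.ncard_congr (fun p _ => p.1 ∪ p.2 ∪ crossings S q) ?_ ?_ ?_
  · rintro ⟨X, Y⟩ ⟨hX, hY⟩
    exact ⟨IsLozengeTiling.glue hX hY hS, lozV_mem_glue hX hY⟩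
  · rintro ⟨X, Y⟩ ⟨X', Y'⟩ ⟨hX, hY⟩ ⟨hX', hY'⟩ he
    dsimp only at he hX hY hX' hY'
    have h1 := lozAbove_glue hX hY
    have h2 := lozBelow_glue hX hY
    rw [he, lozAbove_glue hX' hY'] at h1
    rw [he, lozBelow_glue hX' hY'] at h2
    rw [h1, h2]
  · rintro T ⟨hT, hTS⟩
    exact ⟨(lozAbove T q, lozBelow T q), ⟨hT.above hTS, hT.below hTS⟩, (hT.eq_union hTS).symm⟩

/-- The family `A` is arbitrary so that the same sorting by crossing set serves both for all tilings
and for the centrally symmetric ones. -/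
theorem ncard_eq_sum_crossings {A : Set (Set (Set UnitTriangle))} (hA : A.Finite)
    (hAR : ∀ T ∈ A, IsLozengeTiling R T) {P : Finset ℤ}
    (hP : ∀ i, i ∈ P ↔ up i q ∈ R ∧ down i (q - 1) ∈ R) :
    A.ncard = ∑ S ∈ P.powerset, {T | T ∈ A ∧ ∀ i, i ∈ S ↔ lozV i q ∈ T}.ncard := by
  classical
  rw [Set.ncard_eq_toFinset_card _ hA, Finset.card_eq_sum_card_fiberwise
    (f := fun T => P.filter fun i => lozV i q ∈ T) (t := P.powerset)]
  · refine Finset.sum_congr rfl fun S hS => ?_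
    rw [← Set.ncard_coe_finset]
    congr 1
    ext T
    simp only [Finset.coe_filter, Set.Finite.mem_toFinset, Set.mem_ofPred_eq]
    refine and_congr_right fun hT => ?_
    have hin : ∀ i, lozV i q ∈ T → i ∈ P := by
      intro i hi
      have := (hAR T hT).subset hi
      exact (hP i).2 ⟨this (by simp [lozV]), this (by simp [lozV])⟩
    constructor
    · rintro rfl i
      simp only [Finset.mem_filter]
      exact ⟨fun h => h.2, fun h => ⟨hin i h, h⟩⟩
    · intro h
      ext i
      rw [Finset.mem_filter, h i]
      exact ⟨fun h => h.2, fun h => ⟨hin i h, h⟩⟩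
  · intro T _
    exact Finset.mem_coe.2 (Finset.mem_powerset.2 (Finset.filter_subset _ _))

/-- Cutting a region along a horizontal line. -/
theorem numTilings_eq_sum (hR : R.Finite) {P : Finset ℤ}
    (hP : ∀ i, i ∈ P ↔ up i q ∈ R ∧ down i (q - 1) ∈ R) :
    numTilings R = ∑ S ∈ P.powerset,
      numTilings (above R q \ ups S q) * numTilings (below R q \ downs S (q - 1)) := by
  rw [numTilings, ncard_eq_sum_crossings (finite_tilings hR) (fun T hT => hT) hP]
  refine Finset.sum_congr rfl fun S hS => ?_
  rw [← ncard_tilings_of_crossings]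
  · rfl
  · intro i hi
    exact (hP i).1 (Finset.mem_powerset.1 hS hi)

end cut

/-! ### Cutting along the axis of a centrally symmetric region -/

section symmetric

variable {R : Set UnitTriangle} {T : Set (Set UnitTriangle)} {q m : ℤ}

theorem image_halfTurn_lozV (m q i : ℤ) :
    halfTurn (m, 2 * q) '' lozV i q = lozV (m - 1 - i) q := by
  rw [lozV, lozV, Set.image_pair, Set.pair_comm]
  simp only [halfTurn]
  congr 2 <;> ring_nf

theorem image_halfTurn_ups (m q : ℤ) (S : Set ℤ) :
    halfTurn (m, 2 * q) '' ups S q = downs ((fun i => m - 1 - i) '' S) (q - 1) := by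
  rw [ups, downs, Set.image_image, Set.image_image]
  congr 1
  ext i
  simp only [halfTurn]
  congr 1 <;> ring

theorem row_halfTurn (m q : ℤ) (t : UnitTriangle) :
    (halfTurn (m, 2 * q) t).row = 2 * q - 1 - t.row := by
  cases t <;> simp only [halfTurn, row] <;> ring

theorem image_halfTurn_above (hR : halfTurn (m, 2 * q) '' R = R) :
    halfTurn (m, 2 * q) '' above R q = below R q := by
  ext t
  rw [mem_image_halfTurn, above, below, Set.mem_ofPred_eq, Set.mem_ofPred_eq, row_halfTurn,
    ← mem_image_halfTurn, hR]
  refine and_congr_right fun _ => ?_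
  omega

theorem numTilings_below (hR : halfTurn (m, 2 * q) '' R = R) (S : Set ℤ) :
    numTilings (below R q \ downs S (q - 1)) =
      numTilings (above R q \ ups ((fun i => m - 1 - i) '' S) q) := by
  rw [← numTilings_image_halfTurn (m, 2 * q) (above R q \ _),
    Set.image_sdiff (halfTurn_involutive _).injective, image_halfTurn_above hR, image_halfTurn_ups,
    Set.image_image]
  simp

theorem lozBelow_of_symmetric (hT : (fun L => halfTurn (m, 2 * q) '' L) '' T = T) :
    lozBelow T q = (fun L => halfTurn (m, 2 * q) '' L) '' lozAbove T q := by
  ext L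
  constructor
  · rintro ⟨hL, hr⟩
    rw [← hT] at hL
    obtain ⟨L, hL, rfl⟩ := hL
    refine ⟨L, ⟨hL, fun t ht => ?_⟩, rfl⟩
    have := hr _ ⟨t, ht, rfl⟩
    rw [row_halfTurn] at this
    omega
  · rintro ⟨L, ⟨hL, hr⟩, rfl⟩
    refine ⟨hT ▸ ⟨L, hL, rfl⟩, ?_⟩
    rintro _ ⟨t, ht, rfl⟩
    have := hr t ht
    rw [row_halfTurn]
    omega

theorem image_halfTurn_crossings (m q : ℤ) (S : Set ℤ) :
    (fun L => halfTurn (m, 2 * q) '' L) '' crossings S q =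
      crossings ((fun i => m - 1 - i) '' S) q := by
  rw [crossings, crossings, Set.image_image, Set.image_image]
  simp only [image_halfTurn_lozV]

/-- A symmetric tiling is recovered from its upper half, the lower half being the image under the
half-turn; `hσ` makes the two halves agree along the axis. -/
theorem ncard_symmetric_of_crossings {S : Set ℤ} (hR : halfTurn (m, 2 * q) '' R = R)
    (hS : ∀ i ∈ S, up i q ∈ R ∧ down i (q - 1) ∈ R) (hσ : (fun i => m - 1 - i) '' S = S) :
    {T | (IsLozengeTiling R T ∧ (fun L => halfTurn (m, 2 * q) '' L) '' T = T) ∧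
      ∀ i, i ∈ S ↔ lozV i q ∈ T}.ncard = numTilings (above R q \ ups S q) := by
  unfold numTilings
  symm
  have hY : ∀ X, IsLozengeTiling (above R q \ ups S q) X →
      IsLozengeTiling (below R q \ downs S (q - 1))
        ((fun L => halfTurn (m, 2 * q) '' L) '' X) := by
    intro X hX
    have := hX.image_halfTurn (m, 2 * q)
    rwa [Set.image_sdiff (halfTurn_involutive _).injective, image_halfTurn_above hR,
      image_halfTurn_ups, hσ] at this
  refine Set.ncard_congr
    (fun X _ => X ∪ (fun L => halfTurn (m, 2 * q) '' L) '' X ∪ crossings S q) ?_ ?_ ?_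
  · intro X hX
    refine ⟨⟨IsLozengeTiling.glue hX (hY X hX) hS, ?_⟩, lozV_mem_glue hX (hY X hX)⟩
    rw [Set.image_union, Set.image_union, image_image_image_halfTurn, image_halfTurn_crossings, hσ,
      Set.union_comm X]
  · intro X X' hX hX' he
    have h1 := lozAbove_glue hX (hY X hX)
    rw [he, lozAbove_glue hX' (hY X' hX')] at h1
    exact h1.symm
  · rintro T ⟨⟨hT, hs⟩, hTS⟩
    refine ⟨lozAbove T q, hT.above hTS, ?_⟩
    rw [← lozBelow_of_symmetric hs]
    exact (hT.eq_union hTS).symm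

/-- Cutting a region along the horizontal line through its center of symmetry. -/
theorem numCentrallySymmetricTilings_eq_sum (hR : R.Finite) (hsym : halfTurn (m, 2 * q) '' R = R)
    {P : Finset ℤ} (hP : ∀ i, i ∈ P ↔ up i q ∈ R ∧ down i (q - 1) ∈ R) :
    numCentrallySymmetricTilings (m, 2 * q) R =
      ∑ S ∈ P.powerset with S.image (fun i => m - 1 - i) = S,
        numTilings (above R q \ ups S q) := by
  rw [numCentrallySymmetricTilings,
    ncard_eq_sum_crossings ((finite_tilings hR).subset fun T hT => hT.1) (fun T hT => hT.1) hP,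
    Finset.sum_filter]
  refine Finset.sum_congr rfl fun S hS => ?_
  split_ifs with hσ
  · refine ncard_symmetric_of_crossings hsym
      (fun i hi => (hP i).1 (Finset.mem_powerset.1 hS hi)) ?_
    rw [← Finset.coe_image, hσ]
  -- The crossing set of a symmetric tiling is invariant under reflection, so any other `S`
  -- contributes nothing.
  · refine (congrArg Set.ncard (Set.eq_empty_of_forall_notMem ?_)).trans (Set.ncard_empty _)
    rintro T ⟨⟨hT, hs⟩, hTS⟩
    have h1 : ∀ i, lozV i q ∈ T → lozV (m - 1 - i) q ∈ T := by
      intro i hi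
      rw [← hs]
      exact ⟨_, hi, image_halfTurn_lozV m q i⟩
    refine hσ (Finset.ext fun i => ?_)
    rw [Finset.mem_image]
    constructor
    · rintro ⟨k, hk, rfl⟩
      exact (hTS _).2 (h1 _ ((hTS _).1 hk))
    · intro hi
      exact ⟨m - 1 - i, (hTS _).2 (h1 _ ((hTS _).1 hi)), by ring⟩

end symmetric

/-! ### Tilings of a strip of height one -/

/-- The number of elements of `A` below `t`. -/
def countBelow (A : Finset ℤ) (t : ℤ) : ℤ := ((A.filter (· < t)).card : ℤ)

theorem countBelow_succ (A : Finset ℤ) (t : ℤ) :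
    countBelow A (t + 1) = countBelow A t + if t ∈ A then 1 else 0 := by
  unfold countBelow
  split_ifs with h
  · have : A.filter (· < t + 1) = insert t (A.filter (· < t)) := by
      ext i
      simp only [Finset.mem_filter, Finset.mem_insert]
      constructor
      · rintro ⟨hi, hlt⟩
        rcases eq_or_ne i t with rfl | hne
        · exact .inl rfl
        · exact .inr ⟨hi, by omega⟩
      · rintro (rfl | ⟨hi, hlt⟩)
        · exact ⟨h, by omega⟩
        · exact ⟨hi, by omega⟩
    rw [this, Finset.card_insert_of_notMem (by simp)]
    push_cast; rfl
  · rw [add_zero]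
    congr 2
    ext i
    simp only [Finset.mem_filter]
    refine and_congr_right fun hi => ⟨fun hlt => ?_, fun hlt => by omega⟩
    have : i ≠ t := by rintro rfl; exact h hi
    omega

theorem countBelow_of_forall_le {A : Finset ℤ} {t : ℤ} (h : ∀ i ∈ A, t ≤ i) :
    countBelow A t = 0 := by
  rw [countBelow, Finset.filter_eq_empty_iff.2 (fun i hi => not_lt.2 (h i hi))]; rfl

theorem countBelow_of_forall_lt {A : Finset ℤ} {t : ℤ} (h : ∀ i ∈ A, i < t) :
    countBelow A t = A.card := by
  rw [countBelow, Finset.filter_true_of_mem h]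

/-- `X` and `Y` are the positions of the two kinds of lozenges in a tiling of a strip that consists
of the up-pointing triangles at `A` and the down-pointing triangles at `B`. -/
def IsStripMatching (A B : Finset ℤ) (X Y : Set ℤ) : Prop :=
  ∀ i, (i ∈ A ↔ i ∈ X ∨ i - 1 ∈ Y) ∧ ¬ (i ∈ X ∧ i - 1 ∈ Y) ∧
    (i ∈ B ↔ i ∈ X ∨ i ∈ Y) ∧ ¬ (i ∈ X ∧ i ∈ Y)

/-- The set of lozenges of a strip at height `q` given by positions. -/
def stripLozenges (X Y : Set ℤ) (q : ℤ) : Set (Set UnitTriangle) :=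
  (fun i => lozR i q) '' X ∪ (fun i => lozL i q) '' Y

theorem IsStripMatching.isLozengeTiling {A B : Finset ℤ} {X Y : Set ℤ}
    (h : IsStripMatching A B X Y) (q : ℤ) :
    IsLozengeTiling (ups A q ∪ downs B q) (stripLozenges X Y q) := by
  refine ⟨?_, ?_, ?_⟩
  · rintro _ (⟨i, -, rfl⟩ | ⟨i, -, rfl⟩)
    · exact isLozenge_lozR i q
    · exact isLozenge_lozL i q
  · rintro _ (⟨i, hi, rfl⟩ | ⟨i, hi, rfl⟩) _ (⟨k, hk, rfl⟩ | ⟨k, hk, rfl⟩) hne <;>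
      refine Set.disjoint_left.2 fun t ht ht' => hne ?_ <;>
      dsimp only [id, lozR, lozL] at ht ht' <;>
      rcases ht with rfl | rfl <;>
      simp only [Set.mem_insert_iff, Set.mem_singleton_iff, up.injEq, down.injEq, and_true,
        reduceCtorEq, or_false, false_or, add_left_inj] at ht'
    · rw [ht']
    · rw [ht']
    · exact ((h i).2.1 ⟨hi, by rw [ht']; simpa using hk⟩).elim
    · exact ((h i).2.2.2 ⟨hi, by rwa [ht']⟩).elim
    · exact ((h i).2.2.2 ⟨by rwa [ht'], hi⟩).elim
    · exact ((h k).2.1 ⟨hk, by rw [← ht']; simpa using hi⟩).elim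
    · rw [ht']
    · rw [ht']
  · ext t
    simp only [stripLozenges, Set.sUnion_union, Set.sUnion_image, Set.mem_union, Set.mem_iUnion,
      lozR, lozL, Set.mem_insert_iff, Set.mem_singleton_iff]
    rcases t with ⟨i, j⟩ | ⟨i, j⟩
    · simp only [up.injEq, reduceCtorEq, or_false, false_or, up_mem_ups, up_not_mem_downs,
        Finset.mem_coe, (h i).1]
      constructor
      · rintro (⟨k, hk, rfl, rfl⟩ | ⟨k, hk, rfl, rfl⟩)
        · exact ⟨.inl hk, rfl⟩
        · exact ⟨.inr (by simpa using hk), rfl⟩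
      · rintro ⟨hi | hi, rfl⟩
        · exact .inl ⟨i, hi, rfl, rfl⟩
        · exact .inr ⟨i - 1, hi, by ring, rfl⟩
    · simp only [down.injEq, reduceCtorEq, or_false, false_or, down_mem_downs, down_not_mem_ups,
        Finset.mem_coe, (h i).2.2.1]
      constructor
      · rintro (⟨k, hk, rfl, rfl⟩ | ⟨k, hk, rfl, rfl⟩)
        · exact ⟨.inl hk, rfl⟩
        · exact ⟨.inr hk, rfl⟩
      · rintro ⟨hi | hi, rfl⟩
        · exact .inl ⟨i, hi, rfl, rfl⟩
        · exact .inr ⟨i, hi, rfl, rfl⟩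

theorem IsLozengeTiling.eq_stripLozenges {A B : Finset ℤ} {q : ℤ} {T : Set (Set UnitTriangle)}
    (h : IsLozengeTiling (ups A q ∪ downs B q) T) :
    T = stripLozenges {i | lozR i q ∈ T} {i | lozL i q ∈ T} q := by
  ext L
  constructor
  · intro hL
    have hs := h.subset hL
    obtain ⟨i, j, rfl | rfl | rfl⟩ := (h.isLozenge L hL).cases
    · have : up i j ∈ ups A q ∪ downs B q := hs (by simp [lozR])
      obtain rfl : j = q := by simp at this; exact this.2
      exact .inl ⟨i, hL, rfl⟩
    · have : down i j ∈ ups A q ∪ downs B q := hs (by simp [lozL])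
      obtain rfl : j = q := by simp at this; exact this.2
      exact .inr ⟨i, hL, rfl⟩
    · have h1 : up i j ∈ ups A q ∪ downs B q := hs (by simp [lozV])
      have h2 : down i (j - 1) ∈ ups A q ∪ downs B q := hs (by simp [lozV])
      simp only [Set.mem_union, up_mem_ups, up_not_mem_downs, or_false, down_not_mem_ups,
        down_mem_downs, false_or] at h1 h2
      omega
  · rintro (⟨i, hi, rfl⟩ | ⟨i, hi, rfl⟩) <;> exact hi

theorem IsLozengeTiling.isStripMatching {A B : Finset ℤ} {q : ℤ} {T : Set (Set UnitTriangle)}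
    (h : IsLozengeTiling (ups A q ∪ downs B q) T) :
    IsStripMatching A B {i | lozR i q ∈ T} {i | lozL i q ∈ T} := by
  have hT := h.eq_stripLozenges
  have hV : ∀ i j, lozV i j ∉ T := by
    intro i j hL
    have hs := h.subset hL
    have h1 : up i j ∈ ups A q ∪ downs B q := hs (by simp [lozV])
    have h2 : down i (j - 1) ∈ ups A q ∪ downs B q := hs (by simp [lozV])
    simp only [Set.mem_union, up_mem_ups, up_not_mem_downs, or_false, down_not_mem_ups,
      down_mem_downs, false_or] at h1 h2
    omega
  have hup : ∀ i, i ∈ A ↔ up i q ∈ ups (A : Set ℤ) q ∪ downs B q := by intro i; simp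
  have hdown : ∀ i, i ∈ B ↔ down i q ∈ ups (A : Set ℤ) q ∪ downs B q := by intro i; simp
  intro i
  simp only [Set.mem_ofPred_eq]
  refine ⟨?_, ?_, ?_, ?_⟩
  · rw [hup]
    constructor
    · intro ht
      obtain ⟨L, hL, htL⟩ := h.exists_mem ht
      rcases (h.isLozenge L hL).eq_of_up_mem htL with rfl | rfl | rfl
      · exact .inl hL
      · exact .inr hL
      · exact (hV _ _ hL).elim
    · rintro (hL | hL)
      · exact h.subset hL (by simp [lozR])
      · exact h.subset hL (by simp [lozL])
  · rintro ⟨h1, h2⟩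
    have := h.eq_of_mem (t := up i q) h1 h2 (by simp [lozR]) (by simp [lozL])
    have h3 : down i q ∈ lozL (i - 1) q := by rw [← this]; simp [lozR]
    simp [lozL] at h3
    omega
  · rw [hdown]
    constructor
    · intro ht
      obtain ⟨L, hL, htL⟩ := h.exists_mem ht
      rcases (h.isLozenge L hL).eq_of_down_mem htL with rfl | rfl | rfl
      · exact .inl hL
      · exact .inr hL
      · exact (hV _ _ hL).elim
    · rintro (hL | hL)
      · exact h.subset hL (by simp [lozR])
      · exact h.subset hL (by simp [lozL])
  · rintro ⟨h1, h2⟩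
    have := h.eq_of_mem (t := down i q) h1 h2 (by simp [lozR]) (by simp [lozL])
    have h3 : up (i + 1) q ∈ lozR i q := by rw [this]; simp [lozL]
    simp [lozR] at h3

/-- From left to right the strip reads `up t`, `down t`, `up (t + 1)`, and so on. Cut it just after
`down t`: a lozenge to the left of the cut adds one to both counts, and the only lozenge that can
straddle the cut is the one joining `down t` to `up (t + 1)`. -/
theorem IsStripMatching.countBelow_sub {A B : Finset ℤ} {X Y : Set ℤ} [DecidablePred (· ∈ Y)]
    (h : IsStripMatching A B X Y) (t : ℤ) :
    countBelow B (t + 1) - countBelow A (t + 1) = if t ∈ Y then 1 else 0 := by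
  classical
  obtain ⟨m, hm⟩ : ∃ m : ℤ, ∀ i ∈ A ∪ B, m ≤ i := by
    obtain ⟨m, hm⟩ := (A ∪ B).bddBelow
    exact ⟨m, fun i hi => hm hi⟩
  -- To the left of all triangles both counts vanish; this anchors the induction on `t`.
  have hlow : ∀ t < m, countBelow B (t + 1) - countBelow A (t + 1) = if t ∈ Y then 1 else 0 := by
    intro t ht
    rw [countBelow_of_forall_le, countBelow_of_forall_le, if_neg]
    · rfl
    · intro hY
      have := hm t (Finset.mem_union_right _ ((h t).2.2.1.2 (.inr hY)))
      omega
    · intro i hi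
      have := hm i (Finset.mem_union_left _ hi)
      omega
    · intro i hi
      have := hm i (Finset.mem_union_right _ hi)
      omega
  rcases lt_or_ge t m with ht | ht
  · exact hlow t ht
  · induction t, (show m - 1 ≤ t by omega) using Int.leInduction with
    | base => exact hlow _ (by omega)
    | succ t hmt ih =>
      have ih' : countBelow B (t + 1) - countBelow A (t + 1) = if t ∈ Y then 1 else 0 := by
        rcases lt_or_ge t m with ht' | ht'
        · exact hlow t ht'
        · exact ih ht'
      rw [countBelow_succ B (t + 1), countBelow_succ A (t + 1)]
      obtain ⟨h1, h2, h3, h4⟩ := h (t + 1)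
      rw [add_sub_cancel_right] at h1 h2
      by_cases c1 : t ∈ Y <;> by_cases c2 : t + 1 ∈ Y <;> by_cases c3 : t + 1 ∈ X <;>
        simp_all <;> omega

/-- The numerical condition for a strip to be tileable. -/
def StripCondition (A B : Finset ℤ) : Prop :=
  ∀ t, countBelow B t ≤ countBelow A (t + 1) ∧ countBelow A (t + 1) ≤ countBelow B (t + 1)

/-- In a strip each triangle has only its left and right neighbours available, so the matching is
forced from the left. The differences of counts on either side of a triangle are the indicators of
`X` and `Y`; being 0 or 1, they also give the strip condition. -/
theorem IsStripMatching.eq {A B : Finset ℤ} {X Y : Set ℤ} (h : IsStripMatching A B X Y) :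
    X = {t | countBelow B t ≠ countBelow A (t + 1)} ∧
      Y = {t | countBelow A (t + 1) ≠ countBelow B (t + 1)} ∧ StripCondition A B := by
  classical
  have key := h.countBelow_sub
  have hX : ∀ t, countBelow A (t + 1) - countBelow B t = if t ∈ X then 1 else 0 := by
    intro t
    have h1 := key (t - 1)
    rw [sub_add_cancel] at h1
    rw [countBelow_succ A t]
    obtain ⟨h2, h3, -, -⟩ := h t
    by_cases c1 : t ∈ X <;> by_cases c2 : t - 1 ∈ Y <;> simp_all <;> omega
  refine ⟨?_, ?_, ?_⟩
  · ext t
    have := hX t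
    rw [Set.mem_ofPred_eq]
    split_ifs at this with h1
    · exact ⟨fun _ => by omega, fun _ => h1⟩
    · exact ⟨fun h2 => absurd h2 h1, fun _ => by omega⟩
  · ext t
    have := key t
    rw [Set.mem_ofPred_eq]
    split_ifs at this with h1
    · exact ⟨fun _ => by omega, fun _ => h1⟩
    · exact ⟨fun h2 => absurd h2 h1, fun _ => by omega⟩
  · intro t
    have h1 := hX t
    have h2 := key t
    split_ifs at h1 h2 <;> omega

theorem StripCondition.isStripMatching {A B : Finset ℤ} (h : StripCondition A B) :
    IsStripMatching A B {t | countBelow B t ≠ countBelow A (t + 1)}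
      {t | countBelow A (t + 1) ≠ countBelow B (t + 1)} := by
  intro i
  simp only [Set.mem_ofPred_eq, sub_add_cancel]
  have h1 := h i
  have h2 := h (i - 1)
  rw [sub_add_cancel] at h2
  have h3 := countBelow_succ A i
  have h4 := countBelow_succ B i
  split_ifs at h3 h4 with c1 c2 c2 <;> simp only [c1, c2, true_iff, false_iff] <;> omega

open Classical in
theorem numTilings_strip (A B : Finset ℤ) (q : ℤ) :
    numTilings (ups A q ∪ downs B q) = if StripCondition A B then 1 else 0 := by
  unfold numTilings
  split_ifs with h
  · rw [Set.ncard_eq_one]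
    refine ⟨_, Set.eq_singleton_iff_unique_mem.2 ⟨h.isStripMatching.isLozengeTiling q, ?_⟩⟩
    intro T hT
    have h1 := IsLozengeTiling.isStripMatching hT
    rw [IsLozengeTiling.eq_stripLozenges hT, h1.eq.1, h1.eq.2.1]
  · refine (congrArg Set.ncard (Set.eq_empty_of_forall_notMem ?_)).trans (Set.ncard_empty _)
    intro T hT
    exact h (IsLozengeTiling.isStripMatching hT).eq.2.2

/-! ### Interlacing sets and Vandermonde products -/

/-- The elements of `D'` separate those of `D`. -/
def Interlaces (D D' : Finset ℤ) : Prop :=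
  D.card = D'.card + 1 ∧
    ∀ t, countBelow D' (t + 1) ≤ countBelow D (t + 1) ∧ countBelow D (t + 1) ≤ countBelow D' t + 1

theorem countBelow_sdiff {A D : Finset ℤ} (h : D ⊆ A) (t : ℤ) :
    countBelow (A \ D) t = countBelow A t - countBelow D t := by
  unfold countBelow
  have : (A \ D).filter (· < t) = A.filter (· < t) \ D.filter (· < t) := by
    ext i; simp only [Finset.mem_filter, Finset.mem_sdiff]; tauto
  rw [this, Finset.card_sdiff_of_subset (Finset.filter_subset_filter _ h), Nat.cast_sub]
  exact Finset.card_le_card (Finset.filter_subset_filter _ h)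

theorem countBelow_Ico (p r t : ℤ) : countBelow (Finset.Ico p r) t = max 0 (min r t - p) := by
  unfold countBelow
  rw [Finset.Ico_filter_lt, Int.card_Ico, Int.toNat_eq_max]
  omega

/-- Passing to complements turns the bounds on counts into the interlacing bounds with the roles of
the two inequalities exchanged. The equation between the cardinalities is the condition at the right
end of the strip, which has one more up-pointing position than down-pointing ones. -/
theorem stripCondition_iff_interlaces {D D' : Finset ℤ} {p r : ℤ} (hpr : p ≤ r)
    (hD : D ⊆ Finset.Ico p (r + 1)) (hD' : D' ⊆ Finset.Ico p r) :
    StripCondition (Finset.Ico p (r + 1) \ D) (Finset.Ico p r \ D') ↔ Interlaces D D' := by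
  have hl : ∀ t ≤ p, countBelow D t = 0 := fun t ht =>
    countBelow_of_forall_le fun i hi => by have := Finset.mem_Ico.1 (hD hi); omega
  have hl' : ∀ t ≤ p, countBelow D' t = 0 := fun t ht =>
    countBelow_of_forall_le fun i hi => by have := Finset.mem_Ico.1 (hD' hi); omega
  have hu : ∀ t, r + 1 ≤ t → countBelow D t = D.card := fun t ht =>
    countBelow_of_forall_lt fun i hi => by have := Finset.mem_Ico.1 (hD hi); omega
  have hu' : ∀ t, r ≤ t → countBelow D' t = D'.card := fun t ht =>
    countBelow_of_forall_lt fun i hi => by have := Finset.mem_Ico.1 (hD' hi); omega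
  unfold StripCondition Interlaces
  simp only [countBelow_sdiff hD, countBelow_sdiff hD', countBelow_Ico]
  have hp := hl' p le_rfl
  constructor
  · intro h
    have hc : D.card = D'.card + 1 := by
      have := h r
      rw [hu _ le_rfl, hu' _ le_rfl, hu' _ (by omega)] at this
      omega
    refine ⟨hc, fun t => ?_⟩
    have h1 := h t
    rcases lt_or_ge t p with ht | ht
    · rw [hl _ (by omega), hl' _ (by omega), hl' _ (by omega)]; omega
    rcases lt_or_ge t r with ht' | ht'
    · omega
    · rw [hu _ (by omega), hu' _ (by omega), hu' _ (by omega)]; omega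
  · rintro ⟨hc, h⟩ t
    have h1 := h t
    rcases lt_or_ge t p with ht | ht
    · rw [hl _ (by omega), hl' _ (by omega), hl' _ (by omega)]; omega
    rcases lt_or_ge t r with ht' | ht'
    · omega
    · rw [hu _ (by omega), hu' _ (by omega), hu' _ (by omega)]; omega

/-- The Vandermonde product of a finite set of integers. -/
def vand (D : Finset ℤ) : ℤ := ∏ x ∈ D, ∏ y ∈ D, if x < y then y - x else 1

theorem vand_pos (D : Finset ℤ) : 0 < vand D := by
  refine Finset.prod_pos fun x _ => Finset.prod_pos fun y _ => ?_
  split_ifs <;> omega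

theorem vand_union {A B : Finset ℤ} (h : Disjoint A B) :
    vand (A ∪ B) = vand A * vand B * ∏ x ∈ A, ∏ y ∈ B, |x - y| := by
  unfold vand
  rw [Finset.prod_union h]
  simp only [Finset.prod_union h, Finset.prod_mul_distrib]
  have : ∏ x ∈ A, ∏ y ∈ B, |x - y| = (∏ x ∈ A, ∏ y ∈ B, if x < y then y - x else 1) *
      ∏ x ∈ B, ∏ y ∈ A, if x < y then y - x else 1 := by
    rw [Finset.prod_comm (s := B), ← Finset.prod_mul_distrib]
    refine Finset.prod_congr rfl fun x hx => ?_
    rw [← Finset.prod_mul_distrib]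
    refine Finset.prod_congr rfl fun y hy => ?_
    have hne : x ≠ y := fun he => Finset.disjoint_left.1 h hx (he ▸ hy)
    rcases lt_or_gt_of_ne hne with hlt | hlt
    · rw [if_pos hlt, if_neg (by omega), abs_of_neg (by omega)]; ring
    · rw [if_neg (by omega), if_pos hlt, abs_of_pos (by omega)]; ring
  rw [this]; ring

theorem vand_image {n : ℕ} {d : Fin n → ℤ} (hd : StrictMono d) :
    vand (Finset.univ.image d) = (Matrix.vandermonde d).det := by
  unfold vand
  rw [Matrix.det_vandermonde, Finset.prod_image fun _ _ _ _ h => hd.injective h]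
  refine Finset.prod_congr rfl fun i _ => ?_
  rw [Finset.prod_image fun _ _ _ _ h => hd.injective h]
  simp only [hd.lt_iff_lt]
  rw [← Finset.prod_filter]
  congr 1
  ext j; simp

theorem lt_countBelow_image_iff {n : ℕ} {d : Fin n → ℤ} (hd : StrictMono d) (i : Fin n) (t : ℤ) :
    (i : ℤ) < countBelow (Finset.univ.image d) t ↔ d i < t := by
  unfold countBelow
  have : ((Finset.univ.image d).filter (· < t)).card =
      (Finset.univ.filter fun k => d k < t).card := by
    rw [Finset.filter_image, Finset.card_image_of_injective _ hd.injective]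
  rw [this]
  constructor
  · intro h
    by_contra hcon
    have hsub : (Finset.univ.filter fun k => d k < t) ⊆ Finset.Iio i := by
      intro k hk
      rw [Finset.mem_filter] at hk
      rw [Finset.mem_Iio, ← hd.lt_iff_lt]
      omega
    have := Finset.card_le_card hsub
    rw [Fin.card_Iio] at this
    omega
  · intro h
    have hsub : Finset.Iic i ⊆ Finset.univ.filter fun k => d k < t := by
      intro k hk
      rw [Finset.mem_filter]
      have := hd.monotone (Finset.mem_Iic.1 hk)
      exact ⟨Finset.mem_univ _, by omega⟩
    have := Finset.card_le_card hsub
    rw [Fin.card_Iic] at this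
    omega

theorem countBelow_le_card (A : Finset ℤ) (t : ℤ) : countBelow A t ≤ A.card := by
  unfold countBelow
  exact_mod_cast Finset.card_filter_le _ _

/-- Passes from counts, natural for strips, to inequalities that let each `e i` range independently
over an interval, as multilinearity of the determinant requires. -/
theorem interlaces_image_iff {n : ℕ} {d : Fin (n + 1) → ℤ} {e : Fin n → ℤ} (hd : StrictMono d)
    (he : StrictMono e) :
    Interlaces (Finset.univ.image d) (Finset.univ.image e) ↔
      ∀ i, d i.castSucc ≤ e i ∧ e i < d i.succ := by
  have hcd : (Finset.univ.image d).card = n + 1 := by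
    rw [Finset.card_image_of_injective _ hd.injective, Finset.card_fin]
  have hce : (Finset.univ.image e).card = n := by
    rw [Finset.card_image_of_injective _ he.injective, Finset.card_fin]
  constructor
  · rintro ⟨-, h⟩ i
    obtain ⟨h1, h2⟩ := h (e i)
    have h3 := (lt_countBelow_image_iff he i (e i + 1)).2 (by omega)
    have h4 := lt_countBelow_image_iff he i (e i)
    have h5 := lt_countBelow_image_iff hd i.castSucc (e i + 1)
    have h6 := lt_countBelow_image_iff hd i.succ (e i + 1)
    simp only [Fin.val_castSucc, Fin.val_succ] at h5 h6
    push_cast at h6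
    constructor
    · have := h5.1 (by omega); omega
    · by_contra hcon
      have := h6.2 (by omega)
      have := h4.1 (by omega)
      omega
  · intro h
    refine ⟨by rw [hcd, hce], fun t => ⟨?_, ?_⟩⟩
    · by_contra hcon
      have hk := countBelow_le_card (Finset.univ.image e) (t + 1)
      rw [hce] at hk
      have h0 : 0 ≤ countBelow (Finset.univ.image d) (t + 1) := by unfold countBelow; positivity
      obtain ⟨k, hk'⟩ := Int.eq_ofNat_of_zero_le h0
      have hkn : k < n := by omega
      have h1 := (lt_countBelow_image_iff he ⟨k, hkn⟩ (t + 1)).1 (by dsimp only; omega)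
      have h2 := h ⟨k, hkn⟩
      have h3 := (lt_countBelow_image_iff hd (Fin.castSucc ⟨k, hkn⟩) (t + 1)).2 (by omega)
      simp only [Fin.castSucc_mk] at h3
      omega
    · by_contra hcon
      have hk := countBelow_le_card (Finset.univ.image d) (t + 1)
      rw [hcd] at hk
      have h0 : 0 ≤ countBelow (Finset.univ.image e) t := by unfold countBelow; positivity
      obtain ⟨k, hk'⟩ := Int.eq_ofNat_of_zero_le h0
      have hkn : k < n := by push_cast at hk; omega
      have h1 := (lt_countBelow_image_iff hd (Fin.succ ⟨k, hkn⟩) (t + 1)).1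
        (by simp only [Fin.succ_mk]; push_cast; omega)
      have h2 := h ⟨k, hkn⟩
      have h3 := (lt_countBelow_image_iff he ⟨k, hkn⟩ t).2 (by omega)
      dsimp only at h3
      omega

/-- The discrete counterpart of integrating a power: the forward difference of the falling factorial
of degree `j + 1` is `j + 1` times the one of degree `j`, and the sum telescopes. -/
theorem sum_descPochhammer_eval (j : ℕ) {a b : ℤ} (h : a ≤ b) :
    ((j : ℤ) + 1) * ∑ k ∈ Finset.Ico a b, (descPochhammer ℤ j).eval k =
      (descPochhammer ℤ (j + 1)).eval b - (descPochhammer ℤ (j + 1)).eval a := by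
  have hstep : ∀ k : ℤ, (descPochhammer ℤ (j + 1)).eval (k + 1) =
      (descPochhammer ℤ (j + 1)).eval k + ((j : ℤ) + 1) * (descPochhammer ℤ j).eval k := by
    intro k
    have h1 : (descPochhammer ℤ (j + 1)).eval (k + 1) = (k + 1) * (descPochhammer ℤ j).eval k := by
      rw [descPochhammer_succ_left]
      simp
    rw [h1, descPochhammer_succ_eval]
    ring
  induction b, h using Int.leInduction with
  | base => simp
  | succ b hab ih =>
    have hins : Finset.Ico a (b + 1) = insert b (Finset.Ico a b) := by
      ext k; simp only [Finset.mem_Ico, Finset.mem_insert]; omega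
    rw [hins, Finset.sum_insert (by simp), mul_add, ih, hstep]
    ring

theorem det_vandermonde_eq_det_descPochhammer {n : ℕ} (v : Fin n → ℤ) :
    (Matrix.vandermonde v).det =
      (Matrix.of fun i j : Fin n => (descPochhammer ℤ j).eval (v i)).det :=
  Matrix.det_eval_matrixOfPolynomials_eq_det_vandermonde v (fun j => descPochhammer ℤ j)
    (fun j => descPochhammer_natDegree ℤ j) (fun j => monic_descPochhammer ℤ j)

/-- Write the Vandermonde determinant in falling factorials and sum each row over its own interval.
After the factors of `n!` are absorbed into the columns, the entries are differences of falling
factorials at consecutive `d`, which is what row operations produce from the larger Vandermonde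
matrix. -/
theorem det_sum_interlacing {n : ℕ} {d : Fin (n + 1) → ℤ} (hd : StrictMono d) :
    (n.factorial : ℤ) * ∑ e ∈ Fintype.piFinset fun i : Fin n => Finset.Ico (d i.castSucc) (d i.succ),
      (Matrix.vandermonde e).det = (Matrix.vandermonde d).det := by
  have h1 : ∑ e ∈ Fintype.piFinset fun i : Fin n => Finset.Ico (d i.castSucc) (d i.succ),
      (Matrix.vandermonde e).det = (Matrix.of fun i j : Fin n =>
        ∑ k ∈ Finset.Ico (d i.castSucc) (d i.succ), (descPochhammer ℤ j).eval k).det := by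
    simp only [det_vandermonde_eq_det_descPochhammer]
    have := (Matrix.detRowAlternating (n := Fin n) (R := ℤ)).toMultilinearMap.map_sum_finset
      (fun (_ : Fin n) (k : ℤ) (j : Fin n) => (descPochhammer ℤ j).eval k)
      (fun i => Finset.Ico (d i.castSucc) (d i.succ))
    have h2 : (fun i => ∑ k ∈ Finset.Ico (d i.castSucc) (d i.succ),
        (fun j : Fin n => (descPochhammer ℤ j).eval k)) = Matrix.of fun i j : Fin n =>
        ∑ k ∈ Finset.Ico (d i.castSucc) (d i.succ), (descPochhammer ℤ j).eval k := by
      ext i j; simp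
    rw [h2] at this
    exact this.symm
  have h3 : (n.factorial : ℤ) = ∏ j : Fin n, ((j : ℤ) + 1) := by
    rw [Fin.prod_univ_eq_prod_range (fun j => ((j : ℤ) + 1)), ← Finset.prod_range_add_one_eq_factorial]
    push_cast; rfl
  rw [h1, h3, ← Matrix.det_mul_row, det_vandermonde_eq_det_descPochhammer]
  -- Subtract from each row its predecessor. Column zero consists of ones, so it becomes (1, 0, …,
  -- 0), and expansion along it leaves the matrix of differences.
  have h4 : (Matrix.of fun i j : Fin (n + 1) => (descPochhammer ℤ j).eval (d i)).det =
      (Matrix.of fun i j : Fin (n + 1) => Fin.cases (motive := fun _ => ℤ)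
        ((descPochhammer ℤ j).eval (d 0))
        (fun k : Fin n => (descPochhammer ℤ j).eval (d k.succ) -
          (descPochhammer ℤ j).eval (d k.castSucc)) i).det := by
    refine Matrix.det_eq_of_forall_row_eq_smul_add_pred (fun _ => 1) (fun j => ?_) (fun i j => ?_)
    · simp
    · simp
  rw [h4, Matrix.det_succ_column_zero, Fin.sum_univ_succ, Finset.sum_eq_zero, add_zero]
  · simp only [Matrix.of_apply, Fin.cases_zero, Fin.val_zero, pow_zero, descPochhammer_zero,
      Polynomial.eval_one, one_mul]
    congr 1
    ext i j
    simp only [Matrix.of_apply, Matrix.submatrix_apply, Fin.succAbove_zero, Fin.cases_succ,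
      Fin.val_succ]
    exact sum_descPochhammer_eval j (hd.monotone (Fin.castSucc_lt_succ).le)
  · intro i _
    simp

theorem Interlaces.subset {D D' : Finset ℤ} (h : Interlaces D D') {p r : ℤ}
    (hD : D ⊆ Finset.Ico p (r + 1)) : D' ⊆ Finset.Ico p r := by
  intro i hi
  have h1 := countBelow_succ D' i
  rw [if_pos hi] at h1
  have h0 : 0 ≤ countBelow D' i := by unfold countBelow; positivity
  have h2 := countBelow_le_card D' (i + 1)
  rw [Finset.mem_Ico]
  constructor
  · by_contra hcon
    have h3 : countBelow D (i + 1) = 0 :=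
      countBelow_of_forall_le fun k hk => by have := Finset.mem_Ico.1 (hD hk); omega
    have := (h.2 i).1
    omega
  · by_contra hcon
    have h3 : countBelow D (i + 1) = D.card :=
      countBelow_of_forall_lt fun k hk => by have := Finset.mem_Ico.1 (hD hk); omega
    have := (h.2 i).2
    have := h.1
    omega

-- The determinant identity in terms of finite sets; `hP` ensures that the powerset of `P` misses no
-- interlacing set.
open Classical in
theorem sum_vand_interlaces {n : ℕ} {D P : Finset ℤ} (hD : D.card = n + 1)
    (hP : ∀ D', Interlaces D D' → D' ⊆ P) :
    (n.factorial : ℤ) * ∑ D' ∈ P.powerset with Interlaces D D', vand D' = vand D := by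
  have hd : StrictMono (D.orderEmbOfFin hD) := (D.orderEmbOfFin hD).strictMono
  have hDim : D = Finset.univ.image (D.orderEmbOfFin hD) := by
    rw [← Finset.coe_inj, Finset.coe_image]; simp
  generalize (D.orderEmbOfFin hD : Fin (n + 1) → ℤ) = d at hd hDim
  rw [hDim, vand_image hd, ← det_sum_interlacing hd, ← hDim]
  congr 1
  symm
  -- Consecutive intervals are disjoint and ordered, so every tuple in the box is increasing and is
  -- recovered from its set of values.
  have hmono : ∀ e ∈ Fintype.piFinset fun i : Fin n => Finset.Ico (d i.castSucc) (d i.succ),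
      StrictMono e := by
    intro e he
    simp only [Fintype.mem_piFinset, Finset.mem_Ico] at he
    intro i j hij
    have h1 : i.succ ≤ j.castSucc := by
      rw [Fin.le_def]; simpa using hij
    have := hd.monotone h1
    have := (he i).2
    have := (he j).1
    omega
  refine Finset.sum_bij (fun e _ => Finset.univ.image e) ?_ ?_ ?_ ?_
  · intro e he
    have hi : Interlaces D (Finset.univ.image e) := by
      rw [hDim, interlaces_image_iff hd (hmono e he)]
      simpa [Fintype.mem_piFinset, Finset.mem_Ico] using he
    exact Finset.mem_filter.2 ⟨Finset.mem_powerset.2 (hP _ hi), hi⟩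
  · intro e he e' he' heq
    refine (hmono e he).range_inj (hmono e' he') |>.1 ?_
    simpa using congrArg (fun s : Finset ℤ => (s : Set ℤ)) heq
  · intro D' hD'
    have hi := (Finset.mem_filter.1 hD').2
    have hc : D'.card = n := by have := hi.1; omega
    have he : StrictMono (D'.orderEmbOfFin hc) := (D'.orderEmbOfFin hc).strictMono
    have hDe : D' = Finset.univ.image (D'.orderEmbOfFin hc) := by
      rw [← Finset.coe_inj, Finset.coe_image]; simp
    refine ⟨D'.orderEmbOfFin hc, ?_, hDe.symm⟩
    rw [hDe, hDim, interlaces_image_iff hd he] at hi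
    simpa [Fintype.mem_piFinset, Finset.mem_Ico] using hi
  · intro e he
    exact (vand_image (hmono e he)).symm

/-! ### Dented trapezoids and the Cohn–Larsen–Propp formula -/

theorem finite_of_bounded {R : Set UnitTriangle} (a b c d : ℤ)
    (h : ∀ i j, up i j ∈ R → (a ≤ i ∧ i ≤ b) ∧ c ≤ j ∧ j ≤ d)
    (h' : ∀ i j, down i j ∈ R → (a ≤ i ∧ i ≤ b) ∧ c ≤ j ∧ j ≤ d) : R.Finite := by
  have hf : (Set.Icc a b ×ˢ Set.Icc c d).Finite := (Set.finite_Icc a b).prod (Set.finite_Icc c d)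
  refine ((hf.image fun p => up p.1 p.2).union (hf.image fun p => down p.1 p.2)).subset ?_
  rintro (⟨i, j⟩ | ⟨i, j⟩) ht
  · exact .inl ⟨(i, j), h i j ht, rfl⟩
  · exact .inr ⟨(i, j), h' i j ht, rfl⟩

/-- The trapezoid with base of length `N` starting at `(p, q)`, and height `n`. -/
def trapezoid (n N : ℕ) (p q : ℤ) : Set UnitTriangle :=
  trianglesIn {v | p ≤ v.1 ∧ q ≤ v.2 ∧ v.2 ≤ q + n ∧ v.1 + v.2 ≤ p + q + N}

theorem up_mem_trapezoid {n N : ℕ} {p q i j : ℤ} : up i j ∈ trapezoid n N p q ↔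
    p ≤ i ∧ q ≤ j ∧ j + 1 ≤ q + n ∧ i + j + 1 ≤ p + q + N := by
  simp only [trapezoid, trianglesIn, vertices, Finset.mem_insert, Finset.mem_singleton,
    Set.mem_ofPred_eq, forall_eq_or_imp, forall_eq]
  omega

theorem down_mem_trapezoid {n N : ℕ} {p q i j : ℤ} : down i j ∈ trapezoid n N p q ↔
    p ≤ i ∧ q ≤ j ∧ j + 1 ≤ q + n ∧ i + j + 2 ≤ p + q + N := by
  simp only [trapezoid, trianglesIn, vertices, Finset.mem_insert, Finset.mem_singleton,
    Set.mem_ofPred_eq, forall_eq_or_imp, forall_eq]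
  omega

theorem up_mem_upLobe {m : ℕ} {p q i j : ℤ} : up i j ∈ upLobe m p q ↔
    p ≤ i ∧ q ≤ j ∧ i + j + 1 ≤ p + q + m := by
  simp only [upLobe, trianglesIn, vertices, Finset.mem_insert, Finset.mem_singleton,
    Set.mem_ofPred_eq, forall_eq_or_imp, forall_eq]
  omega

theorem down_mem_upLobe {m : ℕ} {p q i j : ℤ} : down i j ∈ upLobe m p q ↔
    p ≤ i ∧ q ≤ j ∧ i + j + 2 ≤ p + q + m := by
  simp only [upLobe, trianglesIn, vertices, Finset.mem_insert, Finset.mem_singleton,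
    Set.mem_ofPred_eq, forall_eq_or_imp, forall_eq]
  omega

theorem up_mem_downLobe {m : ℕ} {p q i j : ℤ} : up i j ∈ downLobe m p q ↔
    i + 1 ≤ p + m ∧ j + 1 ≤ q ∧ p + q ≤ i + j := by
  simp only [downLobe, trianglesIn, vertices, Finset.mem_insert, Finset.mem_singleton,
    Set.mem_ofPred_eq, forall_eq_or_imp, forall_eq]
  omega

theorem down_mem_downLobe {m : ℕ} {p q i j : ℤ} : down i j ∈ downLobe m p q ↔
    i + 1 ≤ p + m ∧ j + 1 ≤ q ∧ p + q ≤ i + j + 1 := by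
  simp only [downLobe, trianglesIn, vertices, Finset.mem_insert, Finset.mem_singleton,
    Set.mem_ofPred_eq, forall_eq_or_imp, forall_eq]
  omega

theorem finite_trapezoid (n N : ℕ) (p q : ℤ) : (trapezoid n N p q).Finite := by
  refine finite_of_bounded p (p + N) q (q + n) ?_ ?_
  · intro i j h
    rw [up_mem_trapezoid] at h
    omega
  · intro i j h
    rw [down_mem_trapezoid] at h
    omega

theorem numTilings_empty : numTilings ∅ = 1 := by
  rw [numTilings, Set.ncard_eq_one]
  refine ⟨∅, Set.eq_singleton_iff_unique_mem.2 ⟨⟨by simp, by simp, by simp⟩, ?_⟩⟩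
  intro T hT
  refine Set.eq_empty_of_forall_notMem fun L hL => ?_
  obtain ⟨t, ht⟩ := (IsLozengeTiling.isLozenge hT L hL).nonempty
  exact IsLozengeTiling.subset hT hL ht

theorem hyperfactorial_succ (n : ℕ) : hyperfactorial (n + 1) = hyperfactorial n * n.factorial :=
  Finset.prod_range_succ _ _

theorem hyperfactorial_pos (n : ℕ) : 0 < hyperfactorial n :=
  Finset.prod_pos fun _ _ => Nat.factorial_pos _

theorem trapezoid_zero (N : ℕ) (p q : ℤ) : trapezoid 0 N p q = ∅ := by
  refine Set.eq_empty_of_forall_notMem ?_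
  rintro (⟨i, j⟩ | ⟨i, j⟩) ht
  · rw [up_mem_trapezoid] at ht; omega
  · rw [down_mem_trapezoid] at ht; omega

theorem above_trapezoid (n N : ℕ) (p q : ℤ) (D : Set ℤ) :
    above (trapezoid (n + 1) (N + 1) p q \ ups D q) (q + 1) = trapezoid n N p (q + 1) := by
  ext t
  rcases t with ⟨i, j⟩ | ⟨i, j⟩
  · simp only [above, Set.mem_ofPred_eq, Set.mem_sdiff, up_mem_trapezoid, up_mem_ups, row]
    push_cast
    constructor
    · rintro ⟨⟨h1, h2⟩, h3⟩; omega
    · intro h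
      exact ⟨⟨by omega, fun h' => by omega⟩, by omega⟩
  · simp only [above, Set.mem_ofPred_eq, Set.mem_sdiff, down_mem_trapezoid, down_not_mem_ups, row,
      not_false_eq_true, and_true]
    push_cast
    omega

theorem below_trapezoid (n N : ℕ) (p q : ℤ) (D : Finset ℤ) (D' : Finset ℤ) :
    below (trapezoid (n + 1) (N + 1) p q \ ups D q) (q + 1) \ downs D' q =
      ups ((Finset.Ico p (p + N + 1) \ D : Finset ℤ) : Set ℤ) q ∪
        downs ((Finset.Ico p (p + N) \ D' : Finset ℤ) : Set ℤ) q := by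
  ext t
  rcases t with ⟨i, j⟩ | ⟨i, j⟩
  · simp only [below, Set.mem_ofPred_eq, Set.mem_sdiff, up_mem_trapezoid, up_mem_ups, row,
      up_not_mem_downs, Set.mem_union, Finset.mem_coe, Finset.mem_sdiff, Finset.mem_Ico]
    push_cast
    constructor
    · rintro ⟨⟨⟨h1, h2⟩, h3⟩, -⟩
      exact .inl ⟨⟨by omega, fun h => h2 ⟨h, by omega⟩⟩, by omega⟩
    · rintro (⟨⟨h1, h2⟩, h3⟩ | h)
      · exact ⟨⟨⟨by omega, fun h => h2 h.1⟩, by omega⟩, not_false⟩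
      · exact h.elim
  · simp only [below, Set.mem_ofPred_eq, Set.mem_sdiff, down_mem_trapezoid, down_not_mem_ups, row,
      down_mem_downs, Set.mem_union, Finset.mem_coe, Finset.mem_sdiff, Finset.mem_Ico]
    push_cast
    constructor
    · rintro ⟨⟨⟨h1, -⟩, h3⟩, h4⟩
      exact .inr ⟨⟨by omega, fun h => h4 ⟨h, by omega⟩⟩, by omega⟩
    · rintro (h | ⟨⟨h1, h2⟩, h3⟩)
      · exact h.elim
      · exact ⟨⟨⟨by omega, not_false⟩, by omega⟩, fun h => h2 h.1⟩

/-- The Cohn–Larsen–Propp formula for the tilings of a dented trapezoid. -/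
theorem numTilings_trapezoid (n N : ℕ) (p q : ℤ) (D : Finset ℤ) (hn : n ≤ N)
    (hD : D ⊆ Finset.Ico p (p + N)) (h0 : n = 0 → D = ∅) :
    (numTilings (trapezoid n N p q \ ups D q) : ℤ) * hyperfactorial n =
      if D.card = n then vand D else 0 := by
  classical
  induction n generalizing N q D with
  | zero =>
    -- A trapezoid of height 0 is empty and has one tiling whatever `D` is, so the formula needs
    -- `h0` to exclude dents off the region.
    rw [trapezoid_zero, Set.empty_sdiff, numTilings_empty, h0 rfl]
    simp [hyperfactorial, vand]
  | succ n ih =>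
    obtain ⟨N, rfl⟩ : ∃ M, N = M + 1 := ⟨N - 1, by omega⟩
    push_cast at hD
    rw [← add_assoc] at hD
    -- A lozenge crossing the line above the bottom strip needs a second strip, absent when the
    -- height is one.
    set P : Finset ℤ := if n = 0 then ∅ else Finset.Ico p (p + N) with hPdef
    have hP : ∀ i, i ∈ P ↔ up i (q + 1) ∈ trapezoid (n + 1) (N + 1) p q \ ups D q ∧
        down i (q + 1 - 1) ∈ trapezoid (n + 1) (N + 1) p q \ ups D q := by
      intro i
      simp only [Set.mem_sdiff, up_mem_trapezoid, down_mem_trapezoid, up_mem_ups, down_not_mem_ups,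
        hPdef]
      push_cast
      split_ifs with h
      · constructor
        · intro h; simp at h
        · rintro ⟨⟨h1, -⟩, -⟩; omega
      · rw [Finset.mem_Ico]
        constructor
        · intro h1
          exact ⟨⟨by omega, fun h2 => by omega⟩, by omega, not_false⟩
        · rintro ⟨⟨h1, -⟩, -⟩; omega
    have hPI : P ⊆ Finset.Ico p (p + N) := by
      rw [hPdef]; split_ifs <;> simp
    -- The bottom strip contributes the indicator of interlacing, and what remains is a trapezoid of
    -- height `n` with dents `D'`. Summing with `sum_vand_interlaces` costs the factor `n!` by which
    -- the hyperfactorial grows.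
    have hterm : ∀ D' ∈ P.powerset,
        ((numTilings (above (trapezoid (n + 1) (N + 1) p q \ ups D q) (q + 1) \ ups D' (q + 1)) *
          numTilings (below (trapezoid (n + 1) (N + 1) p q \ ups D q) (q + 1) \
            downs D' (q + 1 - 1)) : ℕ) : ℤ) * hyperfactorial n =
        if Interlaces D D' then (if D'.card = n then vand D' else 0) else 0 := by
      intro D' hD'
      rw [Finset.mem_powerset] at hD'
      rw [above_trapezoid, add_sub_cancel_right, below_trapezoid, numTilings_strip]
      simp only [stripCondition_iff_interlaces (show p ≤ p + N by omega) hD (hD'.trans hPI)]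
      split_ifs with h1 h2
      · rw [mul_one, ih N (q + 1) D' (by omega) (hD'.trans hPI), if_pos h2]
        rintro rfl
        simpa using h2
      · rw [mul_one, ih N (q + 1) D' (by omega) (hD'.trans hPI), if_neg ‹_›]
        rintro rfl
        simpa [hPdef] using hD'
      · simp
    rw [numTilings_eq_sum ((finite_trapezoid _ _ _ _).subset Set.sdiff_subset) hP,
      hyperfactorial_succ]
    push_cast
    rw [← mul_assoc, Finset.sum_mul]
    rw [Finset.sum_congr rfl fun D' hD' => by
      have := hterm D' hD'
      push_cast at this
      exact this]
    rw [← Finset.sum_filter]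
    split_ifs with hc
    · rw [← sum_vand_interlaces hc (P := P), mul_comm]
      · congr 1
        refine Finset.sum_congr rfl fun D' hD' => ?_
        have := (Finset.mem_filter.1 hD').2.1
        rw [if_pos (by omega)]
      · intro D' hI
        rw [hPdef]
        split_ifs with h
        · have := hI.1
          rw [Finset.subset_empty, ← Finset.card_eq_zero]
          omega
        · exact hI.subset hD
    · rw [Finset.sum_eq_zero, zero_mul]
      intro D' hD'
      have := (Finset.mem_filter.1 hD').2.1
      rw [if_neg (by omega)]

/-! ### Forced lozenges: lobes versus runs of dents -/

/-- The forced lozenges above a run of dents. -/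
def lobeLozenges (m : ℕ) (p q : ℤ) : Set (Set UnitTriangle) :=
  {L | ∃ i j, L = lozV i j ∧ p ≤ i ∧ q < j ∧ i + j + 1 ≤ p + q + m}

theorem sUnion_lobeLozenges (m : ℕ) (p q : ℤ) :
    ⋃₀ lobeLozenges m p q = upLobe m p q \ ups (Set.Ico p (p + m)) q := by
  ext t
  constructor
  · rintro ⟨_, ⟨i, j, rfl, h1, h2, h3⟩, rfl | rfl⟩
    · rw [Set.mem_sdiff, down_mem_upLobe]
      exact ⟨by omega, down_not_mem_ups⟩
    · rw [Set.mem_sdiff, up_mem_upLobe, up_mem_ups]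
      exact ⟨by omega, fun h => by omega⟩
  · rcases t with ⟨i, j⟩ | ⟨i, j⟩
    · rw [Set.mem_sdiff, up_mem_upLobe, up_mem_ups, Set.mem_Ico]
      rintro ⟨h1, h2⟩
      exact ⟨lozV i j, ⟨i, j, rfl, by omega, by omega, by omega⟩, by simp [lozV]⟩
    · rw [Set.mem_sdiff, down_mem_upLobe]
      rintro ⟨h1, -⟩
      exact ⟨lozV i (j + 1), ⟨i, j + 1, rfl, by omega, by omega, by omega⟩, by simp [lozV]⟩

theorem isLozengeTiling_lobeLozenges (m : ℕ) (p q : ℤ) :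
    IsLozengeTiling (⋃₀ lobeLozenges m p q) (lobeLozenges m p q) := by
  refine ⟨?_, ?_, rfl⟩
  · rintro _ ⟨i, j, rfl, -⟩; exact isLozenge_lozV i j
  · rintro _ ⟨i, j, rfl, -⟩ _ ⟨k, l, rfl, -⟩ hne
    refine Set.disjoint_left.2 fun t ht ht' => hne ?_
    dsimp only [id, lozV] at ht ht'
    rcases ht with rfl | rfl <;>
      simp only [Set.mem_insert_iff, Set.mem_singleton_iff, up.injEq, down.injEq, reduceCtorEq,
        or_false, false_or] at ht'
    · obtain ⟨rfl, h⟩ := ht'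
      obtain rfl : j = l := by omega
      rfl
    · obtain ⟨rfl, rfl⟩ := ht'
      rfl

/-- In the bottom row of the lobe both horizontal neighbours of each down-pointing triangle are
dents, so it must pair with the triangle above it. The triangles thus used up act as a run of dents,
one shorter, for the next row. -/
theorem lobeLozenges_subset {m : ℕ} {p q : ℤ} {R : Set UnitTriangle} (hR : upLobe m p q ⊆ R)
    {T : Set (Set UnitTriangle)} (hT : IsLozengeTiling (R \ ups (Set.Ico p (p + m)) q) T) :
    lobeLozenges m p q ⊆ T := by
  have key : ∀ k : ℕ, ∀ i, p ≤ i → i + (q + 1 + k) + 1 ≤ p + q + m → lozV i (q + 1 + k) ∈ T := by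
    intro k
    induction k with
    | zero =>
      intro i hi him
      push_cast at him ⊢
      rw [add_zero] at him ⊢
      have hd : down i q ∈ R \ ups (Set.Ico p (p + m)) q :=
        ⟨hR (down_mem_upLobe.2 (by omega)), down_not_mem_ups⟩
      obtain ⟨L, hL, hdL⟩ := hT.exists_mem hd
      rcases (hT.isLozenge L hL).eq_of_down_mem hdL with rfl | rfl | rfl
      · have : up i q ∈ lozR i q := by simp [lozR]
        exact absurd (up_mem_ups.2 ⟨Set.mem_Ico.2 (by omega), rfl⟩) (hT.subset hL this).2
      · have : up (i + 1) q ∈ lozL i q := by simp [lozL]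
        exact absurd (up_mem_ups.2 ⟨Set.mem_Ico.2 (by omega), rfl⟩) (hT.subset hL this).2
      · exact hL
    | succ k ih =>
      intro i hi him
      push_cast at him ⊢
      rw [← add_assoc] at him ⊢
      have hd : down i (q + 1 + k) ∈ R \ ups (Set.Ico p (p + m)) q :=
        ⟨hR (down_mem_upLobe.2 (by omega)), down_not_mem_ups⟩
      obtain ⟨L, hL, hdL⟩ := hT.exists_mem hd
      rcases (hT.isLozenge L hL).eq_of_down_mem hdL with rfl | rfl | rfl
      · have h1 := hT.eq_of_mem hL (ih i hi (by omega)) (t := up i (q + 1 + k)) (by simp [lozR])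
          (by simp [lozV])
        rw [h1] at hdL
        simp [lozV] at hdL
        omega
      · have h1 := hT.eq_of_mem hL (ih (i + 1) (by omega) (by omega)) (t := up (i + 1) (q + 1 + k))
          (by simp [lozL]) (by simp [lozV])
        rw [h1] at hdL
        simp [lozV] at hdL
      · exact hL
  rintro _ ⟨i, j, rfl, h1, h2, h3⟩
  have := key (j - (q + 1)).toNat i h1
  rw [Int.toNat_of_nonneg (by omega), add_sub_cancel] at this
  exact this h3

/-- Removing a run of dents forces the lozenges in the triangle above it. -/
theorem numTilings_diff_upLobe {m : ℕ} {p q : ℤ} {R : Set UnitTriangle} (hR : upLobe m p q ⊆ R) :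
    numTilings (R \ upLobe m p q) = numTilings (R \ ups (Set.Ico p (p + m)) q) := by
  have hsub : ups (Set.Ico p (p + m)) q ⊆ upLobe m p q := by
    rintro _ ⟨i, hi, rfl⟩
    rw [Set.mem_Ico] at hi
    exact up_mem_upLobe.2 (by omega)
  rw [← numTilings_diff_sUnion (isLozengeTiling_lobeLozenges m p q) (R := R \ ups _ q)
    _ (fun T hT => lobeLozenges_subset hR hT), sUnion_lobeLozenges, Set.sdiff_sdiff,
    Set.union_sdiff_cancel hsub]
  rw [sUnion_lobeLozenges]
  exact Set.sdiff_subset_sdiff_left hR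

/-- The positions of the base triangles of the up-pointing lobes in a string of lobes. -/
noncomputable def upSet : Bool → List ℕ → ℤ → Finset ℤ
  | _, [], _ => ∅
  | true, m :: l, p => Finset.Ico p (p + m) ∪ upSet false l (p + m)
  | false, m :: l, p => upSet true l (p + m)

theorem dents_eq_ups (b : Bool) (l : List ℕ) (p : ℤ) : dents b l p = ups (upSet b l p) 0 := by
  induction l generalizing b p with
  | nil => cases b <;> simp [dents, upSet, ups]
  | cons m l ih =>
    cases b
    · simpa only [dents, upSet] using ih true (p + m)
    · simp only [dents, upSet, ih, ups, Finset.coe_union, Set.image_union]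
      congr 1
      ext t
      simp only [Set.mem_ofPred_eq, Finset.coe_Ico, Set.mem_image, Set.mem_Ico]
      constructor
      · rintro ⟨i, h1, h2, rfl⟩; exact ⟨i, ⟨h1, h2⟩, rfl⟩
      · rintro ⟨i, ⟨h1, h2⟩, rfl⟩; exact ⟨i, h1, h2, rfl⟩

theorem upSet_subset (b : Bool) (l : List ℕ) (p : ℤ) :
    upSet b l p ⊆ Finset.Ico p (p + l.sum) := by
  induction l generalizing b p with
  | nil => cases b <;> simp [upSet]
  | cons m l ih =>
    intro i hi
    rw [List.sum_cons, Finset.mem_Ico, Nat.cast_add]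
    cases b
    · have := Finset.mem_Ico.1 (ih true (p + m) hi); omega
    · rcases Finset.mem_union.1 hi with h | h
      · rw [Finset.mem_Ico] at h; omega
      · have := Finset.mem_Ico.1 (ih false (p + m) h); omega

/-- The first coordinate of a unit triangle. -/
def UnitTriangle.col : UnitTriangle → ℤ
  | .up i _ => i
  | .down i _ => i

theorem le_col_of_mem_above_lobes {b : Bool} {l : List ℕ} {p q : ℤ} {t : UnitTriangle}
    (h : t ∈ above (lobes b l p q) q) : p ≤ t.col := by
  induction l generalizing b p with
  | nil => cases b <;> simp [lobes, above] at h
  | cons m l ih =>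
    obtain ⟨h, hr⟩ := h
    cases b <;> rcases h with h | h
    · rcases t with ⟨i, j⟩ | ⟨i, j⟩
      · rw [up_mem_downLobe] at h; simp only [row] at hr; omega
      · rw [down_mem_downLobe] at h; simp only [row] at hr; omega
    · have := ih ⟨h, hr⟩; omega
    · rcases t with ⟨i, j⟩ | ⟨i, j⟩
      · rw [up_mem_upLobe] at h; exact h.1
      · rw [down_mem_upLobe] at h; exact h.1
    · have := ih ⟨h, hr⟩; omega

theorem above_union (A B : Set UnitTriangle) (q : ℤ) :
    above (A ∪ B) q = above A q ∪ above B q := by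
  ext t; simp only [above, Set.mem_union, Set.mem_ofPred_eq]; tauto

theorem above_upLobe (m : ℕ) (p q : ℤ) : above (upLobe m p q) q = upLobe m p q := by
  ext t
  refine ⟨fun h => h.1, fun h => ⟨h, ?_⟩⟩
  rcases t with ⟨i, j⟩ | ⟨i, j⟩
  · rw [up_mem_upLobe] at h; exact h.2.1
  · rw [down_mem_upLobe] at h; exact h.2.1

theorem above_downLobe (m : ℕ) (p q : ℤ) : above (downLobe m p q) q = ∅ := by
  refine Set.eq_empty_of_forall_notMem ?_
  rintro (⟨i, j⟩ | ⟨i, j⟩) ⟨h, hr⟩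
  · rw [up_mem_downLobe] at h; simp only [row] at hr; omega
  · rw [down_mem_downLobe] at h; simp only [row] at hr; omega

/-- Lobes above a line may be replaced by the dents at their bases. -/
theorem numTilings_diff_above_lobes {b : Bool} {l : List ℕ} {p q : ℤ} {R : Set UnitTriangle}
    (hR : above (lobes b l p q) q ⊆ R) :
    numTilings (R \ above (lobes b l p q) q) = numTilings (R \ ups (upSet b l p) q) := by
  induction l generalizing b p R with
  | nil => cases b <;> simp [lobes, upSet, above, ups]
  | cons m l ih =>
    cases b
    · simp only [lobes, upSet, above_union, above_downLobe, Set.empty_union] at hR ⊢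
      exact ih hR
    · simp only [lobes, upSet, above_union, above_upLobe] at hR ⊢
      have hsub : ups (Set.Ico p (p + m)) q ⊆ upLobe m p q := by
        rintro _ ⟨i, hi, rfl⟩
        rw [Set.mem_Ico] at hi
        exact up_mem_upLobe.2 (by omega)
      have hdis : Disjoint (upLobe m p q) (above (lobes false l (p + m) q) q) := by
        refine Set.disjoint_left.2 fun t ht ht' => ?_
        have hc := le_col_of_mem_above_lobes ht'
        rcases t with ⟨i, j⟩ | ⟨i, j⟩
        · rw [up_mem_upLobe] at ht; simp only [col] at hc; omega
        · rw [down_mem_upLobe] at ht; simp only [col] at hc; omega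
      rw [Set.union_comm, ← Set.sdiff_sdiff, numTilings_diff_upLobe, Set.sdiff_sdiff, Set.union_comm,
        ← Set.sdiff_sdiff, ih, Set.sdiff_sdiff, Finset.coe_union, Finset.coe_Ico, ups, ups, ups,
        Set.image_union]
      · refine Set.subset_sdiff.2 ⟨Set.subset_union_right.trans hR, (hdis.mono_left hsub).symm⟩
      · exact Set.subset_sdiff.2 ⟨Set.subset_union_left.trans hR, hdis⟩

/-! ### Palindromic ferns of even length -/

theorem oddSum_cons (m : ℕ) (l : List ℕ) : oddSum (m :: l) = m + evenSum l := by
  cases l <;> simp [oddSum, evenSum]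

theorem evenSum_cons (m : ℕ) (l : List ℕ) : evenSum (m :: l) = oddSum l := rfl

theorem oddSum_evenSum_append_singleton (l : List ℕ) (m : ℕ) :
    oddSum (l ++ [m]) = oddSum l + (if l.length.bodd then 0 else m) ∧
      evenSum (l ++ [m]) = evenSum l + (if l.length.bodd then m else 0) := by
  induction l with
  | nil => simp [oddSum, evenSum]
  | cons k l ih =>
    rw [List.cons_append, oddSum_cons, evenSum_cons, oddSum_cons, evenSum_cons, ih.1, ih.2,
      List.length_cons, Nat.bodd_succ]
    cases l.length.bodd <;> simp [add_assoc]

theorem bodd_length_append_reverse (a : List ℕ) : (a ++ a.reverse).length.bodd = false := by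
  simp [Nat.bodd_add]

theorem cons_append_reverse (m : ℕ) (a : List ℕ) :
    (m :: a) ++ (m :: a).reverse = m :: ((a ++ a.reverse) ++ [m]) := by simp

/-- In a palindrome of even length, mirror positions have opposite parity. The proof, like the later
ones on palindromes, peels off the two outermost entries. -/
theorem oddSum_evenSum_append_reverse (a : List ℕ) :
    oddSum (a ++ a.reverse) = a.sum ∧ evenSum (a ++ a.reverse) = a.sum := by
  induction a with
  | nil => simp [oddSum, evenSum]
  | cons m a ih =>
    have := oddSum_evenSum_append_singleton (a ++ a.reverse) m
    rw [bodd_length_append_reverse] at this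
    rw [cons_append_reverse, oddSum_cons, evenSum_cons, this.1, this.2, ih.1, ih.2, List.sum_cons]
    simp [add_comm]

theorem sum_append_reverse (a : List ℕ) : (a ++ a.reverse).sum = 2 * a.sum := by
  rw [List.sum_append, List.sum_reverse, two_mul]

theorem lobes_append (b : Bool) (l₁ l₂ : List ℕ) (p q : ℤ) :
    lobes b (l₁ ++ l₂) p q =
      lobes b l₁ p q ∪ lobes (xor b l₁.length.bodd) l₂ (p + l₁.sum) q := by
  induction l₁ generalizing b p with
  | nil => cases b <;> simp [lobes]
  | cons m l ih =>
    rw [List.length_cons, Nat.bodd_succ, List.sum_cons, Nat.cast_add, ← add_assoc]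
    cases b <;> simp only [List.cons_append, lobes, ih, Set.union_assoc] <;>
      cases l.length.bodd <;> rfl

theorem upSet_append (b : Bool) (l₁ l₂ : List ℕ) (p : ℤ) :
    upSet b (l₁ ++ l₂) p = upSet b l₁ p ∪ upSet (xor b l₁.length.bodd) l₂ (p + l₁.sum) := by
  induction l₁ generalizing b p with
  | nil => cases b <;> simp [upSet]
  | cons m l ih =>
    rw [List.length_cons, Nat.bodd_succ, List.sum_cons, Nat.cast_add, ← add_assoc]
    cases b <;> simp only [List.cons_append, upSet, ih, Finset.union_assoc] <;>
      cases l.length.bodd <;> rfl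

theorem up_mem_lobes {b : Bool} {l : List ℕ} {p q i : ℤ} :
    up i q ∈ lobes b l p q ↔ i ∈ upSet b l p := by
  induction l generalizing b p with
  | nil => cases b <;> simp [lobes, upSet]
  | cons m l ih =>
    cases b
    · simp only [lobes, upSet, Set.mem_union, ih, up_mem_downLobe]
      constructor
      · rintro (h | h)
        · omega
        · exact h
      · exact .inr
    · simp only [lobes, upSet, Set.mem_union, Finset.mem_union, ih, up_mem_upLobe, Finset.mem_Ico]
      refine or_congr_left ?_
      omega

/-- The two outermost lobes have equal size and opposite orientation, so the half-turn about the
middle of the string swaps them; the inner string has the same center. -/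
theorem halfTurn_mem_lobes {b : Bool} {a : List ℕ} {p q : ℤ} {t : UnitTriangle} :
    halfTurn (2 * p + 2 * a.sum, 2 * q) t ∈ lobes b (a ++ a.reverse) p q ↔
      t ∈ lobes b (a ++ a.reverse) p q := by
  induction a generalizing b p with
  | nil => cases b <;> simp [lobes]
  | cons m a ih =>
    have hc : (2 * p + 2 * ((m :: a).sum : ℕ) : ℤ) = 2 * (p + m) + 2 * (a.sum : ℕ) := by
      rw [List.sum_cons, Nat.cast_add]; ring
    have hs : ((a ++ a.reverse).sum : ℤ) = 2 * (a.sum : ℕ) := by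
      rw [sum_append_reverse]; push_cast [-Nat.cast_list_sum]; rfl
    have hlen := bodd_length_append_reverse a
    rw [cons_append_reverse, hc]
    generalize a ++ a.reverse = w at ih hs hlen ⊢
    cases b
    · simp only [lobes, lobes_append, hlen, Set.mem_union, ih, hs,
        Set.union_empty, Bool.xor_false]
      rcases t with ⟨i, j⟩ | ⟨i, j⟩ <;>
        simp only [halfTurn, up_mem_upLobe, up_mem_downLobe, down_mem_downLobe, down_mem_upLobe]
      · constructor
        · rintro (h | h | h)
          · exact .inr (.inr (by omega))
          · exact .inr (.inl h)
          · exact .inl (by omega)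
        · rintro (h | h | h)
          · exact .inr (.inr (by omega))
          · exact .inr (.inl h)
          · exact .inl (by omega)
      · constructor
        · rintro (h | h | h)
          · exact .inr (.inr (by omega))
          · exact .inr (.inl h)
          · exact .inl (by omega)
        · rintro (h | h | h)
          · exact .inr (.inr (by omega))
          · exact .inr (.inl h)
          · exact .inl (by omega)
    · simp only [lobes, lobes_append, hlen, Set.mem_union, ih, hs,
        Set.union_empty, Bool.xor_false]
      rcases t with ⟨i, j⟩ | ⟨i, j⟩ <;>
        simp only [halfTurn, up_mem_upLobe, up_mem_downLobe, down_mem_downLobe, down_mem_upLobe]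
      · constructor
        · rintro (h | h | h)
          · exact .inr (.inr (by omega))
          · exact .inr (.inl h)
          · exact .inl (by omega)
        · rintro (h | h | h)
          · exact .inr (.inr (by omega))
          · exact .inr (.inl h)
          · exact .inl (by omega)
      · constructor
        · rintro (h | h | h)
          · exact .inr (.inr (by omega))
          · exact .inr (.inl h)
          · exact .inl (by omega)
        · rintro (h | h | h)
          · exact .inr (.inr (by omega))
          · exact .inr (.inl h)
          · exact .inl (by omega)

/-- The half-turn exchanges the bases of the up-pointing and the down-pointing lobes of a
palindromic string. -/
theorem reflect_mem_upSet {b : Bool} {a : List ℕ} {p i : ℤ}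
    (hi : i ∈ Finset.Ico p (p + 2 * a.sum)) :
    2 * p + 2 * a.sum - 1 - i ∈ upSet b (a ++ a.reverse) p ↔
      i ∉ upSet b (a ++ a.reverse) p := by
  induction a generalizing b p with
  | nil => simp at hi
  | cons m a ih =>
    have hc : (2 * p + 2 * ((m :: a).sum : ℕ) : ℤ) = 2 * (p + m) + 2 * (a.sum : ℕ) := by
      rw [List.sum_cons, Nat.cast_add]; ring
    have hs : ((a ++ a.reverse).sum : ℤ) = 2 * (a.sum : ℕ) := by
      rw [sum_append_reverse]; push_cast [-Nat.cast_list_sum]; rfl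
    rw [List.sum_cons, Nat.cast_add, Finset.mem_Ico] at hi
    rw [cons_append_reverse, hc]
    have hb : ∀ b i, i ∈ upSet b (a ++ a.reverse) (p + m) →
        p + m ≤ i ∧ i < p + m + 2 * (a.sum : ℕ) := by
      intro b i h
      have := Finset.mem_Ico.1 (upSet_subset _ _ _ h)
      rwa [hs] at this
    have ih' := fun b h => ih (b := b) (p := p + m) (Finset.mem_Ico.2 h)
    have hlen := bodd_length_append_reverse a
    clear ih
    generalize a ++ a.reverse = w at hb ih' hs hlen ⊢
    cases b
    · have h1 := hb true i
      have h2 := hb true (2 * (p + m) + 2 * (a.sum : ℕ) - 1 - i)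
      have h3 : ¬ (p + m ≤ i ∧ i < p + m + 2 * (a.sum : ℕ)) ∨
          (2 * (p + m) + 2 * (a.sum : ℕ) - 1 - i ∈ upSet true w (p + m) ↔
            i ∉ upSet true w (p + m)) := or_iff_not_imp_left.2 fun h => ih' true (not_not.1 h)
      simp only [upSet, upSet_append, hlen, hs, Finset.union_empty,
        Bool.xor_false, Finset.mem_union, Finset.mem_Ico]
      by_cases c1 : i ∈ upSet true w (p + m) <;>
        by_cases c2 : 2 * (p + m) + 2 * (a.sum : ℕ) - 1 - i ∈ upSet true w (p + m) <;>
        simp only [c1, c2, true_or, false_or, or_false, not_true, true_iff, not_false_eq_true, forall_const,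
          iff_false, not_and, not_lt, iff_true] at h1 h2 h3 ⊢ <;> omega
    · have h1 := hb false i
      have h2 := hb false (2 * (p + m) + 2 * (a.sum : ℕ) - 1 - i)
      have h3 : ¬ (p + m ≤ i ∧ i < p + m + 2 * (a.sum : ℕ)) ∨
          (2 * (p + m) + 2 * (a.sum : ℕ) - 1 - i ∈ upSet false w (p + m) ↔
            i ∉ upSet false w (p + m)) := or_iff_not_imp_left.2 fun h => ih' false (not_not.1 h)
      simp only [upSet, upSet_append, hlen, hs, Finset.union_empty,
        Bool.xor_false, Finset.mem_union, Finset.mem_Ico]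
      by_cases c1 : i ∈ upSet false w (p + m) <;>
        by_cases c2 : 2 * (p + m) + 2 * (a.sum : ℕ) - 1 - i ∈ upSet false w (p + m) <;>
        simp only [c1, c2, or_true, or_false, not_true, true_iff, not_false_eq_true, forall_const,
          iff_false, not_and, not_lt, iff_true] at h1 h2 h3 ⊢ <;> omega

/-! ### The upper half of the region as a dented trapezoid -/

/-- The fern-cored hexagon with a palindromic fern of even length and even side parameters. -/
def palindromicRegion (X Y Z : ℕ) (a : List ℕ) : Set UnitTriangle :=
  fernCoredHexagon (2 * X) (2 * Y) (2 * Z) (a ++ a.reverse)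

section region

variable {X Y Z : ℕ} {a : List ℕ}

theorem mem_palindromicRegion {t : UnitTriangle} : t ∈ palindromicRegion X Y Z a ↔
    t ∈ hexagon (2 * X) (2 * Y) (2 * Z) a.sum a.sum ∧
      t ∉ lobes true (a ++ a.reverse) (X + Y) (Z - Y) := by
  rw [palindromicRegion, fernCoredHexagon, (oddSum_evenSum_append_reverse a).1,
    (oddSum_evenSum_append_reverse a).2, fern, Set.mem_sdiff]
  have h1 : (((2 * X : ℕ) : ℤ) + (2 * Y : ℕ)) / 2 = X + Y := by push_cast; omega
  have h2 : (((2 * Z : ℕ) : ℤ) - (2 * Y : ℕ)) / 2 = Z - Y := by push_cast; omega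
  rw [h1, h2]

theorem up_mem_hexagon {A : ℕ} {i j : ℤ} : up i j ∈ hexagon (2 * X) (2 * Y) (2 * Z) A A ↔
    0 ≤ i ∧ i + 1 ≤ 2 * X + 2 * Y + 2 * A ∧ -(2 * Y + A : ℤ) ≤ j ∧ j + 1 ≤ 2 * Z + A ∧
      0 ≤ i + j ∧ i + j + 1 ≤ 2 * X + 2 * Z + 2 * A := by
  simp only [hexagon, trianglesIn, vertices, Finset.mem_insert, Finset.mem_singleton,
    Set.mem_ofPred_eq, forall_eq_or_imp, forall_eq]
  push_cast
  omega

theorem down_mem_hexagon {A : ℕ} {i j : ℤ} : down i j ∈ hexagon (2 * X) (2 * Y) (2 * Z) A A ↔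
    0 ≤ i ∧ i + 1 ≤ 2 * X + 2 * Y + 2 * A ∧ -(2 * Y + A : ℤ) ≤ j ∧ j + 1 ≤ 2 * Z + A ∧
      0 ≤ i + j + 1 ∧ i + j + 2 ≤ 2 * X + 2 * Z + 2 * A := by
  simp only [hexagon, trianglesIn, vertices, Finset.mem_insert, Finset.mem_singleton,
    Set.mem_ofPred_eq, forall_eq_or_imp, forall_eq]
  push_cast
  omega

theorem finite_palindromicRegion : (palindromicRegion X Y Z a).Finite := by
  refine finite_of_bounded 0 (2 * X + 2 * Y + 2 * a.sum) (-(2 * Y + a.sum)) (2 * Z + a.sum) ?_ ?_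
  · intro i j h
    have := up_mem_hexagon.1 (mem_palindromicRegion.1 h).1
    omega
  · intro i j h
    have := down_mem_hexagon.1 (mem_palindromicRegion.1 h).1
    omega

theorem image_halfTurn_palindromicRegion :
    halfTurn (2 * X + 2 * Y + 2 * a.sum, 2 * (Z - Y)) '' palindromicRegion X Y Z a =
      palindromicRegion X Y Z a := by
  ext t
  rw [mem_image_halfTurn, mem_palindromicRegion, mem_palindromicRegion,
    show (2 * X + 2 * Y + 2 * (a.sum : ℕ) : ℤ) = 2 * (X + Y) + 2 * (a.sum : ℕ) by ring,
    halfTurn_mem_lobes]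
  refine and_congr_left fun _ => ?_
  rcases t with ⟨i, j⟩ | ⟨i, j⟩
  · rw [halfTurn, up_mem_hexagon, down_mem_hexagon]; dsimp only; omega
  · rw [halfTurn, up_mem_hexagon, down_mem_hexagon]; dsimp only; omega

theorem doubledCenter_eq : doubledCenter (2 * X) (2 * Y) (2 * Z) (a ++ a.reverse) =
    ((2 * X + 2 * Y + 2 * a.sum : ℤ), (2 * (Z - Y) : ℤ)) := by
  rw [doubledCenter, sum_append_reverse]
  push_cast [-Nat.cast_list_sum]
  rw [mul_sub]

/-- The positions along the axis where a lozenge may cross it. -/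
noncomputable def slots (X Y Z A : ℕ) : Finset ℤ :=
  -- The upper half has height `Y + Z + A`. On the axis the hexagon loses a segment of length `max 0
  -- (Y - Z)` at either end, where crossing lozenges would leave it.
  if Y + Z + A = 0 then ∅ else
    Finset.Ico (max 0 (Y - Z : ℤ)) (2 * X + 2 * Y + 2 * A - max 0 (Y - Z : ℤ)) \
      Finset.Ico (X + Y : ℤ) (X + Y + 2 * A)

/-- The dents that complete the upper half of the hexagon to a trapezoid. -/
noncomputable def sideDents (X Y Z A : ℕ) : Finset ℤ :=
  -- The trapezoid exceeds the hexagon by a triangle of side `|Y - Z|`, in the left corner if `Z <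
  -- Y` and in the right corner if `Y < Z`; the other interval is empty.
  Finset.Ico 0 (Y - Z : ℤ) ∪ Finset.Ico (2 * X + 2 * Y + 2 * A : ℤ) (2 * X + Y + Z + 2 * A)

/-- The bases of the up-pointing lobes of the fern. -/
noncomputable def fernDents (X Y : ℕ) (a : List ℕ) : Finset ℤ :=
  upSet true (a ++ a.reverse) (X + Y)

theorem fernDents_subset : fernDents X Y a ⊆ Finset.Ico (X + Y : ℤ) (X + Y + 2 * (a.sum : ℕ)) := by
  have := upSet_subset true (a ++ a.reverse) (X + Y)
  rw [sum_append_reverse] at this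
  rwa [Nat.cast_mul] at this

/-- No lozenge crosses the axis inside the fern: at each position there, either the triangle above
or the one below belongs to a lobe, by `reflect_mem_upSet`. -/
theorem mem_slots_iff {i : ℤ} : i ∈ slots X Y Z a.sum ↔
    up i (Z - Y : ℤ) ∈ palindromicRegion X Y Z a ∧
      down i (Z - Y - 1 : ℤ) ∈ palindromicRegion X Y Z a := by
  rw [mem_palindromicRegion, mem_palindromicRegion, up_mem_lobes,
    ← halfTurn_mem_lobes (t := down i (Z - Y - 1 : ℤ)), halfTurn, up_mem_hexagon, down_mem_hexagon]
  dsimp only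
  rw [show 2 * ((Z : ℤ) - Y) - (Z - Y - 1) - 1 = Z - Y by ring, up_mem_lobes,
    show (2 * (X + Y) + 2 * (a.sum : ℕ) - i - 1 : ℤ) = 2 * (X + Y) + 2 * (a.sum : ℕ) - 1 - i by ring]
  have h1 := reflect_mem_upSet (b := true) (a := a) (p := (X + Y : ℤ)) (i := i)
  have h2 : ∀ k, k ∈ upSet true (a ++ a.reverse) (X + Y : ℤ) →
      (X + Y : ℤ) ≤ k ∧ k < X + Y + 2 * (a.sum : ℕ) := fun k hk =>
    Finset.mem_Ico.1 (fernDents_subset (X := X) (Y := Y) hk)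
  have h3 := h2 i
  have h4 := h2 (2 * (X + Y) + 2 * (a.sum : ℕ) - 1 - i)
  rw [Finset.mem_Ico] at h1
  unfold slots
  generalize (i ∈ upSet true (a ++ a.reverse) (X + Y : ℤ)) = P1 at *
  generalize (2 * (X + Y) + 2 * (a.sum : ℕ) - 1 - i ∈ upSet true (a ++ a.reverse) (X + Y : ℤ)) = P2 at *
  split_ifs with h0
  · simp only [Finset.notMem_empty, false_iff]
    omega
  · rw [Finset.mem_sdiff, Finset.mem_Ico, Finset.mem_Ico]
    constructor
    · rintro ⟨h5, h6⟩
      exact ⟨⟨by omega, fun h => h6 (h3 h)⟩, by omega, fun h => h6 (by have := h4 h; omega)⟩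
    · rintro ⟨⟨h5, h6⟩, h7, h8⟩
      refine ⟨by omega, fun h => ?_⟩
      exact h8 ((h1 h).2 h6)

/-- The string of lobes whose removal turns the trapezoid into the upper half of the region. -/
def lobeString (X Y Z : ℕ) (a : List ℕ) : List ℕ :=
  -- The corner triangles are treated as further up-pointing lobes. Down-pointing lobes, invisible
  -- above the axis, fill the gaps, the lobe of size 0 restores the alternation, and truncated
  -- subtraction suppresses an absent corner.
  [Y - Z, X + Y - (Y - Z)] ++ ((a ++ a.reverse) ++ [0, X + Y, Z - Y])

theorem upSet_lobeString : upSet true (lobeString X Y Z a) 0 =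
    sideDents X Y Z a.sum ∪ fernDents X Y a := by
  have h1 : ((Y - Z : ℕ) : ℤ) + (X + Y - (Y - Z) : ℕ) = X + Y := by omega
  rw [lobeString, upSet_append, upSet_append, bodd_length_append_reverse]
  simp only [upSet, List.length_cons, List.length_nil, List.sum_cons, List.sum_nil,
    sum_append_reverse]
  ext i
  have hb : (Nat.bodd (0 + 1 + 1)) = false := rfl
  rw [hb]
  simp only [Bool.xor_false, upSet, Finset.mem_union, Finset.mem_Ico, sideDents, fernDents,
    Finset.notMem_empty]
  push_cast [-Nat.cast_list_sum]
  simp only [zero_add, add_zero, h1]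
  by_cases hm : i ∈ upSet true (a ++ a.reverse) (X + Y : ℤ)
  · simp [hm]
  · simp only [hm, false_or, or_false]
    constructor <;> intro h <;> omega

end region

/-- The sum of the up-pointing sizes is a crude bound for the height, but it suffices to keep the
lobes of the fern below the top side of the trapezoid. -/
theorem above_lobes_subset (b : Bool) (l : List ℕ) (p q : ℤ) :
    above (lobes b l p q) q ⊆ trapezoid (if b then oddSum l else evenSum l) l.sum p q := by
  induction l generalizing b p with
  | nil => cases b <;> simp [lobes, above]
  | cons m l ih =>
    rintro t ⟨h, hr⟩
    rw [List.sum_cons]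
    cases b
    · rcases h with h | h
      · have : t ∈ above (downLobe m p q) q := ⟨h, hr⟩
        rw [above_downLobe] at this
        exact this.elim
      · have := ih true (p + m) ⟨h, hr⟩
        simp only [if_true, Bool.false_eq_true, if_false, evenSum_cons] at this ⊢
        rcases t with ⟨i, j⟩ | ⟨i, j⟩
        · rw [up_mem_trapezoid] at this ⊢; omega
        · rw [down_mem_trapezoid] at this ⊢; omega
    · rcases h with h | h
      · simp only [if_true, oddSum_cons]
        rcases t with ⟨i, j⟩ | ⟨i, j⟩
        · rw [up_mem_upLobe] at h; rw [up_mem_trapezoid]; omega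
        · rw [down_mem_upLobe] at h; rw [down_mem_trapezoid]; omega
      · have := ih false (p + m) ⟨h, hr⟩
        simp only [if_true, Bool.false_eq_true, if_false, oddSum_cons] at this ⊢
        rcases t with ⟨i, j⟩ | ⟨i, j⟩
        · rw [up_mem_trapezoid] at this ⊢; omega
        · rw [down_mem_trapezoid] at this ⊢; omega

section region

variable {X Y Z : ℕ} {a : List ℕ}

theorem above_lobes_lobeString (q : ℤ) : above (lobes true (lobeString X Y Z a) 0 q) q =
    upLobe (Y - Z) 0 q ∪ above (lobes true (a ++ a.reverse) (X + Y) q) q ∪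
      upLobe (Z - Y) (2 * X + 2 * Y + 2 * a.sum) q := by
  have h1 : ((Y - Z : ℕ) : ℤ) + (X + Y - (Y - Z) : ℕ) = X + Y := by omega
  rw [lobeString, lobes_append, lobes_append, bodd_length_append_reverse, sum_append_reverse]
  have hb : (Nat.bodd [Y - Z, X + Y - (Y - Z)].length) = false := by simp [Nat.bodd_succ]
  have h2 : (([Y - Z, X + Y - (Y - Z)].sum : ℕ) : ℤ) = X + Y := by
    rw [← h1]; simp only [List.sum_cons, List.sum_nil, add_zero]; push_cast; rfl
  have h3 : (X + Y + (2 * a.sum : ℕ) + (0 : ℕ) + (X + Y : ℕ) : ℤ) =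
      2 * X + 2 * Y + 2 * (a.sum : ℕ) := by
    push_cast [-Nat.cast_list_sum]; ring
  rw [hb, h2, zero_add]
  simp only [lobes, above_union, above_upLobe, above_downLobe, Bool.xor_false, Set.union_empty,
    h3]
  rw [← Set.union_assoc]
  congr 2
  have : upLobe 0 (X + Y + (2 * a.sum : ℕ) : ℤ) q = ∅ := by
    refine Set.eq_empty_of_forall_notMem ?_
    rintro (⟨i, j⟩ | ⟨i, j⟩) ht
    · rw [up_mem_upLobe] at ht; omega
    · rw [down_mem_upLobe] at ht; omega
  simp only [this, Set.empty_union]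

theorem above_lobes_lobeString_subset :
    above (lobes true (lobeString X Y Z a) 0 (Z - Y : ℤ)) (Z - Y : ℤ) ⊆
      trapezoid (Y + Z + a.sum) (2 * X + Y + Z + 2 * a.sum) 0 (Z - Y) := by
  rw [above_lobes_lobeString]
  rintro t ((h | h) | h)
  · rcases t with ⟨i, j⟩ | ⟨i, j⟩
    · rw [up_mem_upLobe] at h; rw [up_mem_trapezoid]; omega
    · rw [down_mem_upLobe] at h; rw [down_mem_trapezoid]; omega
  · have := above_lobes_subset _ _ _ _ h
    rw [if_pos rfl, (oddSum_evenSum_append_reverse a).1, sum_append_reverse] at this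
    rcases t with ⟨i, j⟩ | ⟨i, j⟩
    · rw [up_mem_trapezoid] at this ⊢; omega
    · rw [down_mem_trapezoid] at this ⊢; omega
  · rcases t with ⟨i, j⟩ | ⟨i, j⟩
    · rw [up_mem_upLobe] at h; rw [up_mem_trapezoid]; omega
    · rw [down_mem_upLobe] at h; rw [down_mem_trapezoid]; omega

theorem above_palindromicRegion : above (palindromicRegion X Y Z a) (Z - Y : ℤ) =
    trapezoid (Y + Z + a.sum) (2 * X + Y + Z + 2 * a.sum) 0 (Z - Y) \
      above (lobes true (lobeString X Y Z a) 0 (Z - Y : ℤ)) (Z - Y : ℤ) := by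
  rw [above_lobes_lobeString]
  ext t
  rw [above, Set.mem_ofPred_eq, mem_palindromicRegion, Set.mem_sdiff]
  simp only [above, Set.mem_union, Set.mem_ofPred_eq]
  generalize (t ∈ lobes true (a ++ a.reverse) (X + Y : ℤ) (Z - Y : ℤ)) = Q
  rcases t with ⟨i, j⟩ | ⟨i, j⟩
  · simp only [up_mem_hexagon, up_mem_trapezoid, up_mem_upLobe, row]
    by_cases hQ : Q
    · simp only [hQ, not_true, and_false, false_and, true_and, false_iff, not_and, not_not]
      intro h; left; right; omega
    · simp only [hQ, false_and, not_false_eq_true, and_true, or_false]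
      constructor <;> intro h <;> omega
  · simp only [down_mem_hexagon, down_mem_trapezoid, down_mem_upLobe, row]
    by_cases hQ : Q
    · simp only [hQ, not_true, and_false, false_and, true_and, false_iff, not_and, not_not]
      intro h; left; right; omega
    · simp only [hQ, false_and, not_false_eq_true, and_true, or_false]
      constructor <;> intro h <;> omega

/-- The number of tilings of the upper half of the region when a given set of lozenges crosses
the axis. -/
theorem numTilings_above_palindromicRegion {S : Finset ℤ} (hS : S ⊆ slots X Y Z a.sum) :
    (numTilings (above (palindromicRegion X Y Z a) (Z - Y : ℤ) \ ups S (Z - Y)) : ℤ) *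
        hyperfactorial (Y + Z + a.sum) =
      if (S ∪ (sideDents X Y Z a.sum ∪ fernDents X Y a)).card = Y + Z + a.sum then
        vand (S ∪ (sideDents X Y Z a.sum ∪ fernDents X Y a)) else 0 := by
  have hS' : ups (S : Set ℤ) (Z - Y) ⊆ above (palindromicRegion X Y Z a) (Z - Y : ℤ) := by
    rintro _ ⟨i, hi, rfl⟩
    exact ⟨(mem_slots_iff.1 (hS hi)).1, le_rfl⟩
  rw [above_palindromicRegion] at hS' ⊢
  have hups : ups (S ∪ (sideDents X Y Z a.sum ∪ fernDents X Y a) : Finset ℤ) (Z - Y : ℤ) ⊆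
      trapezoid (Y + Z + a.sum) (2 * X + Y + Z + 2 * a.sum) 0 (Z - Y) := by
    rintro _ ⟨i, hi, rfl⟩
    rw [Finset.mem_coe, Finset.mem_union, ← upSet_lobeString, ← up_mem_lobes (q := (Z - Y : ℤ))] at hi
    rcases hi with hi | hi
    · exact (hS' ⟨i, hi, rfl⟩).1
    · exact above_lobes_lobeString_subset ⟨hi, le_rfl⟩
  -- The triangles at `S` are removed first, so that the lobes are exchanged for dents inside the
  -- remaining region.
  rw [Set.sdiff_sdiff, Set.union_comm, ← Set.sdiff_sdiff, numTilings_diff_above_lobes,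
    Set.sdiff_sdiff, upSet_lobeString]
  · have := numTilings_trapezoid (Y + Z + a.sum) (2 * X + Y + Z + 2 * a.sum) 0 (Z - Y)
      (S ∪ (sideDents X Y Z a.sum ∪ fernDents X Y a)) (by omega) ?_ ?_
    · rw [← this, Finset.coe_union S, ups, ups, ups, Set.image_union]
    · intro i hi
      have := up_mem_trapezoid.1 (hups ⟨i, hi, rfl⟩)
      rw [Finset.mem_Ico]
      omega
    · intro h0
      refine Finset.eq_empty_of_forall_notMem fun i hi => ?_
      have := up_mem_trapezoid.1 (hups ⟨i, hi, rfl⟩)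
      omega
  · refine Set.subset_sdiff.2 ⟨above_lobes_lobeString_subset, ?_⟩
    exact (Set.disjoint_sdiff_left.mono_left hS').symm

end region

/-! ### Separating the shape of the fern from the sums over crossings -/

/-- The product of the distances between the points of two sets. -/
def distProd (S U : Finset ℤ) : ℤ := ∏ x ∈ S, ∏ y ∈ U, |x - y|

theorem distProd_pos {S U : Finset ℤ} (h : Disjoint S U) : 0 < distProd S U := by
  refine Finset.prod_pos fun x hx => Finset.prod_pos fun y hy => ?_
  rw [abs_pos, sub_ne_zero]
  rintro rfl
  exact Finset.disjoint_left.1 h hx hy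

theorem distProd_union_left {S S' U : Finset ℤ} (h : Disjoint S S') :
    distProd (S ∪ S') U = distProd S U * distProd S' U := Finset.prod_union h

theorem distProd_union_right {S U U' : Finset ℤ} (h : Disjoint U U') :
    distProd S (U ∪ U') = distProd S U * distProd S U' := by
  unfold distProd
  rw [← Finset.prod_mul_distrib]
  exact Finset.prod_congr rfl fun x _ => Finset.prod_union h

theorem distProd_image_reflect (m : ℤ) (S U : Finset ℤ) :
    distProd (S.image fun i => m - i) (U.image fun i => m - i) = distProd S U := by
  have hinj : Function.Injective fun i : ℤ => m - i := sub_right_injective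
  unfold distProd
  rw [Finset.prod_image fun _ _ _ _ h => hinj h]
  refine Finset.prod_congr rfl fun x _ => ?_
  rw [Finset.prod_image fun _ _ _ _ h => hinj h]
  refine Finset.prod_congr rfl fun y _ => ?_
  rw [abs_sub_comm]
  congr 1
  ring

/-- The half-turn on the positions along the axis. -/
def axisReflect (X Y A : ℕ) (i : ℤ) : ℤ := 2 * X + 2 * Y + 2 * A - 1 - i

theorem axisReflect_involutive (X Y A : ℕ) : Function.Involutive (axisReflect X Y A) := by
  intro i; unfold axisReflect; ring

/-- The positions on the axis that are covered by the fern. -/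
noncomputable def fernInterval (X Y A : ℕ) : Finset ℤ := Finset.Ico (X + Y : ℤ) (X + Y + 2 * A)

section weights

variable {X Y Z : ℕ} {a : List ℕ}

theorem image_axisReflect_fernDents : (fernDents X Y a).image (axisReflect X Y a.sum) =
    fernInterval X Y a.sum \ fernDents X Y a := by
  ext i
  rw [Finset.mem_image, Finset.mem_sdiff]
  have key : ∀ k ∈ fernInterval X Y a.sum,
      axisReflect X Y a.sum k ∈ fernDents X Y a ↔ k ∉ fernDents X Y a := by
    intro k hk
    have := reflect_mem_upSet (b := true) (a := a) hk
    rwa [show 2 * (X + Y : ℤ) + 2 * (a.sum : ℕ) - 1 - k = axisReflect X Y a.sum k by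
      unfold axisReflect; ring] at this
  have hI : ∀ k ∈ fernDents X Y a, axisReflect X Y a.sum k ∈ fernInterval X Y a.sum := by
    intro k hk
    have := Finset.mem_Ico.1 (fernDents_subset hk)
    rw [fernInterval, Finset.mem_Ico, axisReflect]
    omega
  constructor
  · rintro ⟨k, hk, rfl⟩
    refine ⟨hI k hk, fun h => ?_⟩
    exact (key k (fernDents_subset hk)).1 h hk
  · rintro ⟨hi, hi'⟩
    exact ⟨_, (key i hi).2 hi', axisReflect_involutive X Y a.sum i⟩

/-- The fern dents and their mirror image partition an interval of length `2 * a.sum`. -/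
theorem card_fernDents : (fernDents X Y a).card = a.sum := by
  have h1 : ((fernDents X Y a).image (axisReflect X Y a.sum)).card = (fernDents X Y a).card :=
    Finset.card_image_of_injective _ (axisReflect_involutive X Y a.sum).injective
  have h2 := Finset.card_le_card (fernDents_subset (X := X) (Y := Y) (a := a))
  rw [image_axisReflect_fernDents, fernInterval,
    Finset.card_sdiff_of_subset fernDents_subset] at h1
  rw [Int.card_Ico] at h1 h2
  omega

/-- Reflecting both arguments moves the reflection from `S` to the fern dents, whose mirror image is
their complement in the interval. This is where the shape of the fern drops out. -/
theorem distProd_fernDents (S : Finset ℤ) :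
    distProd S (fernDents X Y a) * distProd (S.image (axisReflect X Y a.sum)) (fernDents X Y a) =
      distProd S (fernInterval X Y a.sum) := by
  have h1 := distProd_image_reflect (2 * X + 2 * Y + 2 * a.sum - 1)
    (S.image (axisReflect X Y a.sum)) (fernDents X Y a)
  change distProd ((S.image (axisReflect X Y a.sum)).image (axisReflect X Y a.sum))
    ((fernDents X Y a).image (axisReflect X Y a.sum)) = _ at h1
  rw [Finset.image_image, (axisReflect_involutive X Y a.sum).comp_self, Finset.image_id,
    image_axisReflect_fernDents] at h1
  rw [← h1, ← distProd_union_right Finset.disjoint_sdiff,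
    Finset.union_sdiff_of_subset
      (show fernDents X Y a ⊆ fernInterval X Y a.sum from fernDents_subset)]

theorem disjoint_slots_fernInterval (A : ℕ) : Disjoint (slots X Y Z A) (fernInterval X Y A) := by
  unfold slots
  split_ifs
  · exact Finset.disjoint_empty_left _
  · exact Finset.sdiff_disjoint

theorem disjoint_slots_sideDents (A : ℕ) : Disjoint (slots X Y Z A) (sideDents X Y Z A) := by
  refine Finset.disjoint_left.2 fun i hi hi' => ?_
  unfold slots at hi
  split_ifs at hi
  · simp at hi
  · simp only [Finset.mem_sdiff, Finset.mem_Ico] at hi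
    simp only [sideDents, Finset.mem_union, Finset.mem_Ico] at hi'
    omega

theorem disjoint_sideDents_fernInterval (A : ℕ) :
    Disjoint (sideDents X Y Z A) (fernInterval X Y A) := by
  refine Finset.disjoint_left.2 fun i hi hi' => ?_
  simp only [sideDents, Finset.mem_union, Finset.mem_Ico] at hi
  simp only [fernInterval, Finset.mem_Ico] at hi'
  omega

theorem image_axisReflect_subset {A : ℕ} {S : Finset ℤ} (hS : S ⊆ slots X Y Z A) :
    S.image (axisReflect X Y A) ⊆ slots X Y Z A := by
  intro i hi
  obtain ⟨k, hk, rfl⟩ := Finset.mem_image.1 hi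
  have := hS hk
  unfold slots at this ⊢
  split_ifs at this ⊢
  · simp at this
  · simp only [Finset.mem_sdiff, Finset.mem_Ico, axisReflect] at this ⊢
    omega

/-- The part of the number of tilings that depends on the shape of the fern. -/
noncomputable def fernWeight (X Y Z : ℕ) (a : List ℕ) : ℤ :=
  vand (fernDents X Y a) * distProd (sideDents X Y Z a.sum) (fernDents X Y a)

theorem fernWeight_pos : 0 < fernWeight X Y Z a :=
  mul_pos (vand_pos _)
    (distProd_pos ((disjoint_sideDents_fernInterval a.sum).mono_right fernDents_subset))

theorem vand_dents {S : Finset ℤ} (hS : S ⊆ slots X Y Z a.sum) :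
    vand (S ∪ (sideDents X Y Z a.sum ∪ fernDents X Y a)) =
      fernWeight X Y Z a * (vand (S ∪ sideDents X Y Z a.sum) * distProd S (fernDents X Y a)) := by
  have h1 : Disjoint S (fernDents X Y a) :=
    (disjoint_slots_fernInterval a.sum).mono hS fernDents_subset
  have h2 : Disjoint (sideDents X Y Z a.sum) (fernDents X Y a) :=
    (disjoint_sideDents_fernInterval a.sum).mono_right fernDents_subset
  have h3 : Disjoint S (sideDents X Y Z a.sum) := (disjoint_slots_sideDents a.sum).mono_left hS
  rw [← Finset.union_assoc, vand_union (Finset.disjoint_union_left.2 ⟨h1, h2⟩)]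
  change _ * distProd _ _ = _
  rw [distProd_union_left h3, fernWeight]
  ring

theorem card_dents {S : Finset ℤ} (hS : S ⊆ slots X Y Z a.sum) :
    (S ∪ (sideDents X Y Z a.sum ∪ fernDents X Y a)).card =
      S.card + (sideDents X Y Z a.sum).card + a.sum := by
  have h1 : Disjoint S (fernDents X Y a) :=
    (disjoint_slots_fernInterval a.sum).mono hS fernDents_subset
  have h2 : Disjoint (sideDents X Y Z a.sum) (fernDents X Y a) :=
    (disjoint_sideDents_fernInterval a.sum).mono_right fernDents_subset
  have h3 : Disjoint S (sideDents X Y Z a.sum) := (disjoint_slots_sideDents a.sum).mono_left hS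
  rw [← Finset.union_assoc, Finset.card_union_of_disjoint (Finset.disjoint_union_left.2 ⟨h1, h2⟩),
    Finset.card_union_of_disjoint h3, card_fernDents]

/-- The sets of crossing positions for which the two halves of the region can be tiled. -/
noncomputable def balancedSlots (X Y Z A : ℕ) : Finset (Finset ℤ) :=
  -- A dented trapezoid is tileable only if it has as many dents as its height; the fern accounts
  -- for `A` of them whatever its shape.
  {S ∈ (slots X Y Z A).powerset | S.card + (sideDents X Y Z A).card + A = Y + Z + A}

theorem numTilings_above_eq {S : Finset ℤ} (hS : S ⊆ slots X Y Z a.sum) :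
    (numTilings (above (palindromicRegion X Y Z a) (Z - Y : ℤ) \ ups S (Z - Y)) : ℤ) *
        hyperfactorial (Y + Z + a.sum) =
      if S ∈ balancedSlots X Y Z a.sum then
        fernWeight X Y Z a * (vand (S ∪ sideDents X Y Z a.sum) * distProd S (fernDents X Y a))
      else 0 := by
  rw [numTilings_above_palindromicRegion hS, card_dents hS, vand_dents hS]
  simp only [balancedSlots, Finset.mem_filter, Finset.mem_powerset, hS, true_and]

/-- The part of the number of centrally symmetric tilings that does not depend on the shape of the
fern. -/
noncomputable def symmetricWeight (X Y Z A : ℕ) : ℝ :=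
  ∑ S ∈ balancedSlots X Y Z A with S.image (axisReflect X Y A) = S,
    vand (S ∪ sideDents X Y Z A) * √(distProd S (fernInterval X Y A))

/-- The part of the number of tilings that does not depend on the shape of the fern. -/
noncomputable def totalWeight (X Y Z A : ℕ) : ℝ :=
  ∑ S ∈ balancedSlots X Y Z A, ((vand (S ∪ sideDents X Y Z A) : ℝ) *
    vand (S.image (axisReflect X Y A) ∪ sideDents X Y Z A) * distProd S (fernInterval X Y A))

theorem distProd_nonneg (S U : Finset ℤ) : 0 ≤ distProd S U :=
  Finset.prod_nonneg fun _ _ => Finset.prod_nonneg fun _ _ => abs_nonneg _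

/-- For invariant `S` the two factors in `distProd_fernDents` coincide, so the distance product to
the fern dents is the square root of the one to the whole interval. -/
theorem numCentrallySymmetricTilingsFC_eq :
    (numCentrallySymmetricTilingsFC (2 * X) (2 * Y) (2 * Z) (a ++ a.reverse) : ℝ) *
      hyperfactorial (Y + Z + a.sum) = fernWeight X Y Z a * symmetricWeight X Y Z a.sum := by
  rw [numCentrallySymmetricTilingsFC, doubledCenter_eq]
  change (numCentrallySymmetricTilings _ (palindromicRegion X Y Z a) : ℝ) * _ = _
  rw [numCentrallySymmetricTilings_eq_sum finite_palindromicRegion image_halfTurn_palindromicRegion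
    (fun i => mem_slots_iff), symmetricWeight, Finset.mul_sum]
  change ((∑ S ∈ (slots X Y Z a.sum).powerset with S.image (axisReflect X Y a.sum) = S, _ : ℕ) : ℝ) *
    _ = _
  have hfil : ((balancedSlots X Y Z a.sum).filter fun S => S.image (axisReflect X Y a.sum) = S) =
      ((slots X Y Z a.sum).powerset.filter fun S => S.image (axisReflect X Y a.sum) = S).filter
        fun S => S ∈ balancedSlots X Y Z a.sum := by
    ext S
    simp only [Finset.mem_filter, balancedSlots]
    tauto
  rw [hfil, Finset.sum_filter (fun S => S ∈ balancedSlots X Y Z a.sum), Nat.cast_sum,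
    Finset.sum_mul]
  refine Finset.sum_congr rfl fun S hS => ?_
  obtain ⟨hS, hσ⟩ := Finset.mem_filter.1 hS
  have h1 := numTilings_above_eq (Finset.mem_powerset.1 hS)
  have h2 := distProd_fernDents (X := X) (Y := Y) (a := a) S
  rw [hσ] at h2
  rw [← h2]
  have h3 : √((distProd S (fernDents X Y a) * distProd S (fernDents X Y a) : ℤ) : ℝ) =
      distProd S (fernDents X Y a) := by
    rw [Int.cast_mul, Real.sqrt_mul_self]
    exact_mod_cast distProd_nonneg _ _
  rw [h3]
  have h4 := congrArg (fun n : ℤ => (n : ℝ)) h1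
  push_cast at h4
  rw [h4]

/-- The lower half at `S` is the upper half at the reflected set, so each half contributes one
factor `fernWeight`, and the two distance products to the fern combine by `distProd_fernDents`. -/
theorem numTilings_fernCoredHexagon_eq :
    (numTilings (fernCoredHexagon (2 * X) (2 * Y) (2 * Z) (a ++ a.reverse)) : ℝ) *
      (hyperfactorial (Y + Z + a.sum) : ℝ) ^ 2 =
        (fernWeight X Y Z a : ℝ) ^ 2 * totalWeight X Y Z a.sum := by
  change (numTilings (palindromicRegion X Y Z a) : ℝ) * _ = _
  rw [numTilings_eq_sum (q := (Z - Y : ℤ)) finite_palindromicRegion (fun i => mem_slots_iff),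
    totalWeight, Finset.mul_sum, balancedSlots, Finset.sum_filter, Nat.cast_sum, Finset.sum_mul]
  refine Finset.sum_congr rfl fun S hS => ?_
  have hS' := Finset.mem_powerset.1 hS
  have hσ := image_axisReflect_subset hS'
  rw [numTilings_below image_halfTurn_palindromicRegion S]
  change ((_ * numTilings (above _ _ \ ups (axisReflect X Y a.sum '' S) _) : ℕ) : ℝ) * _ = _
  rw [← Finset.coe_image]
  have h1 := numTilings_above_eq hS'
  have h2 := numTilings_above_eq hσ
  have h3 := distProd_fernDents (X := X) (Y := Y) (a := a) S
  have hc : (S.image (axisReflect X Y a.sum)).card = S.card :=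
    Finset.card_image_of_injective _ (axisReflect_involutive X Y a.sum).injective
  simp only [balancedSlots, Finset.mem_filter, hS, Finset.mem_powerset, hσ, hc, true_and] at h1 h2
  have h4 := congrArg₂ (fun m n : ℤ => ((m * n : ℤ) : ℝ)) h1 h2
  rw [← h3]
  split_ifs at h4 ⊢ with hcard
  · push_cast at h4 ⊢
    linear_combination h4
  · push_cast at h4 ⊢
    linear_combination h4

/-- A symmetric set of crossing positions of the right size. -/
theorem exists_symmetric_balancedSlots (X Y Z A : ℕ) :
    ∃ S ∈ balancedSlots X Y Z A, S.image (axisReflect X Y A) = S := by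
  have hE : ((sideDents X Y Z A).card : ℤ) = |(Y : ℤ) - Z| := by
    rw [sideDents, Finset.card_union_of_disjoint]
    · rw [Int.card_Ico, Int.card_Ico]
      push_cast
      rw [abs_eq_max_neg]
      omega
    · refine Finset.disjoint_left.2 fun i hi hi' => ?_
      rw [Finset.mem_Ico] at hi hi'
      omega
  -- Take the `min Y Z` outermost slots at each end: with the `|Y - Z|` side dents this makes `Y +
  -- Z`, and there is room because `l + k = Y ≤ X + Y`.
  set l : ℤ := max 0 (Y - Z : ℤ) with hl
  set k : ℤ := min Y Z with hk
  refine ⟨Finset.Ico l (l + k) ∪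
    Finset.Ico (2 * X + 2 * Y + 2 * A - l - k) (2 * X + 2 * Y + 2 * A - l), ?_, ?_⟩
  · rw [balancedSlots, Finset.mem_filter, Finset.mem_powerset]
    constructor
    · intro i hi
      simp only [Finset.mem_union, Finset.mem_Ico] at hi
      unfold slots
      split_ifs with h0
      · omega
      · simp only [Finset.mem_sdiff, Finset.mem_Ico]
        omega
    · rw [Finset.card_union_of_disjoint]
      · rw [Int.card_Ico, Int.card_Ico]
        rw [abs_eq_max_neg] at hE
        omega
      · refine Finset.disjoint_left.2 fun i hi hi' => ?_
        rw [Finset.mem_Ico] at hi hi'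
        omega
  · ext i
    simp only [Finset.mem_image, Finset.mem_union, Finset.mem_Ico, axisReflect]
    constructor
    · rintro ⟨j, hj, rfl⟩; omega
    · intro hi
      exact ⟨2 * X + 2 * Y + 2 * A - 1 - i, by omega, by ring⟩

theorem disjoint_fernInterval_of_mem {A : ℕ} {S : Finset ℤ} (hS : S ∈ balancedSlots X Y Z A) :
    Disjoint S (fernInterval X Y A) :=
  (disjoint_slots_fernInterval A).mono_left
    (Finset.mem_powerset.1 (Finset.mem_filter.1 hS).1)

theorem symmetricWeight_pos (X Y Z A : ℕ) : 0 < symmetricWeight X Y Z A := by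
  refine Finset.sum_pos (fun S hS => ?_) ?_
  · have h1 : (0 : ℝ) < vand (S ∪ sideDents X Y Z A) := by exact_mod_cast vand_pos _
    have h2 : (0 : ℝ) < distProd S (fernInterval X Y A) := by
      exact_mod_cast distProd_pos (disjoint_fernInterval_of_mem (Finset.mem_filter.1 hS).1)
    positivity
  · obtain ⟨S, hS, hσ⟩ := exists_symmetric_balancedSlots X Y Z A
    exact ⟨S, Finset.mem_filter.2 ⟨hS, hσ⟩⟩

theorem totalWeight_pos (X Y Z A : ℕ) : 0 < totalWeight X Y Z A := by
  refine Finset.sum_pos (fun S hS => ?_) ?_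
  · have h1 : (0 : ℝ) < vand (S ∪ sideDents X Y Z A) := by exact_mod_cast vand_pos _
    have h2 : (0 : ℝ) < vand (S.image (axisReflect X Y A) ∪ sideDents X Y Z A) := by
      exact_mod_cast vand_pos _
    have h3 : (0 : ℝ) < distProd S (fernInterval X Y A) := by
      exact_mod_cast distProd_pos (disjoint_fernInterval_of_mem hS)
    positivity
  · obtain ⟨S, hS, -⟩ := exists_symmetric_balancedSlots X Y Z A
    exact ⟨S, hS⟩

end weights

/-! ### Evaluating the weight of a fern -/

theorem vand_singleton (c : ℤ) : vand {c} = 1 := by simp [vand]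

theorem prod_abs_sub_above (u : ℤ) (n k : ℕ) :
    (∏ e ∈ Finset.Ico (u + 1 + n) (u + 1 + n + k), |e - u|) * n.factorial = (n + k).factorial := by
  induction k with
  | zero => simp
  | succ k ih =>
    have : Finset.Ico (u + 1 + n) (u + 1 + n + (k + 1 : ℕ)) =
        insert (u + 1 + n + k) (Finset.Ico (u + 1 + n) (u + 1 + n + k)) := by
      ext i; simp only [Finset.mem_Ico, Finset.mem_insert]; omega
    rw [this, Finset.prod_insert (by simp), mul_assoc, ih, abs_of_nonneg (by omega), ← add_assoc,
      Nat.factorial_succ]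
    push_cast
    ring

theorem prod_abs_sub_below (u : ℤ) (n k : ℕ) :
    (∏ e ∈ Finset.Ico (u - n - k) (u - n), |e - u|) * n.factorial = (n + k).factorial := by
  induction k with
  | zero => simp
  | succ k ih =>
    have : Finset.Ico (u - n - (k + 1 : ℕ)) (u - n) =
        insert (u - n - k - 1) (Finset.Ico (u - n - k) (u - n)) := by
      ext i; simp only [Finset.mem_Ico, Finset.mem_insert]; omega
    rw [this, Finset.prod_insert (by simp), mul_assoc, ih, abs_of_nonpos (by omega), ← add_assoc,
      Nat.factorial_succ]
    push_cast
    ring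

theorem vand_Ico (p : ℤ) (n : ℕ) : vand (Finset.Ico p (p + n)) = hyperfactorial n := by
  induction n with
  | zero => simp [vand, hyperfactorial]
  | succ n ih =>
    have h1 : Finset.Ico p (p + (n + 1 : ℕ)) = Finset.Ico p (p + n) ∪ {p + n} := by
      ext i; simp only [Finset.mem_Ico, Finset.mem_union, Finset.mem_singleton]; omega
    rw [h1, vand_union (by simp), ih, vand_singleton, mul_one, hyperfactorial_succ, Nat.cast_mul]
    congr 1
    simp only [Finset.prod_singleton]
    have := prod_abs_sub_below (p + n) 0 n
    simpa using this

theorem upSet_add (b : Bool) (l : List ℕ) (p c : ℤ) :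
    upSet b l (p + c) = (upSet b l p).image (· + c) := by
  induction l generalizing b p with
  | nil => cases b <;> simp [upSet]
  | cons m l ih =>
    have h := fun b => ih b (p + m)
    rw [add_right_comm] at h
    cases b
    · simpa only [upSet] using h true
    · simp only [upSet, h, Finset.image_union, Finset.image_add_right_Ico]
      rw [add_right_comm]

theorem vand_image_add (D : Finset ℤ) (c : ℤ) : vand (D.image (· + c)) = vand D := by
  have hinj : Function.Injective fun i : ℤ => i + c := add_left_injective c
  unfold vand
  rw [Finset.prod_image fun _ _ _ _ h => hinj h]
  refine Finset.prod_congr rfl fun x _ => ?_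
  rw [Finset.prod_image fun _ _ _ _ h => hinj h]
  simp

/-- The tilings of a dented semihexagon are counted by the Vandermonde product of the dents. -/
theorem s_mul_hyperfactorial (X Y : ℕ) (a : List ℕ) :
    (s (a ++ a.reverse) : ℤ) * hyperfactorial a.sum = vand (fernDents X Y a) := by
  have h0 : fernDents X Y a = (upSet true (a ++ a.reverse) 0).image (· + (X + Y : ℤ)) := by
    rw [fernDents, ← upSet_add, zero_add]
  have hc : (upSet true (a ++ a.reverse) 0).card = a.sum := by
    rw [← card_fernDents (X := X) (Y := Y) (a := a), h0,
      Finset.card_image_of_injective _ (add_left_injective _)]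
  have hsub := upSet_subset true (a ++ a.reverse) 0
  rw [sum_append_reverse] at hsub
  have := numTilings_trapezoid a.sum (2 * a.sum) 0 0 (upSet true (a ++ a.reverse) 0) (by omega)
    hsub (fun h => by rw [← Finset.card_eq_zero, hc, h])
  rw [if_pos hc] at this
  rw [h0, vand_image_add, ← this, s, semihexagon, dents_eq_ups, sum_append_reverse,
    (oddSum_evenSum_append_reverse a).1]
  simp only [trapezoid, zero_add]

section weights

variable {X Y Z : ℕ}

/-- The contribution of a single dent at position `u` to the weight of a fern. -/
noncomputable def dentWeight (Y Z : ℕ) (u : ℤ) : ℝ :=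
  -- On the fern `X + Y ≤ u`, so both arguments are nonnegative and `toNat` loses nothing.
  (u.toNat.factorial : ℝ) / ((u + Z - Y).toNat.factorial : ℝ)

theorem dentWeight_pos (u : ℤ) : 0 < dentWeight Y Z u := by
  unfold dentWeight; positivity

theorem prod_sideDents_of_lt {A : ℕ} {u : ℤ} (h : Z < Y) (hu : u ∈ fernInterval X Y A) :
    ((∏ e ∈ sideDents X Y Z A, |e - u| : ℤ) : ℝ) = dentWeight Y Z u := by
  rw [fernInterval, Finset.mem_Ico] at hu
  have hE : sideDents X Y Z A = Finset.Ico (u - (u + Z - Y).toNat - (Y - Z : ℕ))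
      (u - (u + Z - Y).toNat) := by
    ext i; simp only [sideDents, Finset.mem_union, Finset.mem_Ico]; omega
  have h1 := prod_abs_sub_below u (u + Z - Y).toNat (Y - Z)
  rw [← hE, show (u + Z - Y).toNat + (Y - Z) = u.toNat by omega] at h1
  rw [dentWeight, eq_div_iff (by positivity)]
  exact_mod_cast h1

/-- The side dents now lie on the right, and their distances from `u` are the `Z - Y` consecutive
integers following the mirror image of `u`. -/
theorem prod_sideDents_of_le {A : ℕ} {u : ℤ} (h : Y ≤ Z) (hu : u ∈ fernInterval X Y A) :
    ((∏ e ∈ sideDents X Y Z A, |e - u| : ℤ) : ℝ) = (dentWeight Y Z (axisReflect X Y A u))⁻¹ := by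
  rw [fernInterval, Finset.mem_Ico] at hu
  have hE : sideDents X Y Z A = Finset.Ico (u + 1 + (axisReflect X Y A u).toNat)
      (u + 1 + (axisReflect X Y A u).toNat + (Z - Y : ℕ)) := by
    ext i; simp only [sideDents, Finset.mem_union, Finset.mem_Ico, axisReflect]; omega
  have h1 := prod_abs_sub_above u (axisReflect X Y A u).toNat (Z - Y)
  rw [← hE, show (axisReflect X Y A u).toNat + (Z - Y) = (axisReflect X Y A u + Z - Y).toNat by
    unfold axisReflect; omega] at h1
  rw [dentWeight, inv_div, eq_div_iff (by positivity)]
  exact_mod_cast h1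

/-- One formula for both positions of the side dents. If `Y ≤ Z`, inverse weights at mirror images
appear; the mirror images form the complement of the fern dents, so the product over the whole
interval is split off. It depends only on the size of the fern and cancels in ratios. -/
theorem distProd_sideDents (X Y Z A : ℕ) : ∃ C : ℝ, C ≠ 0 ∧ ∀ a : List ℕ, a.sum = A →
    (distProd (sideDents X Y Z A) (fernDents X Y a) : ℝ) =
      C * ∏ u ∈ fernDents X Y a, dentWeight Y Z u := by
  rcases lt_or_ge Z Y with h | h
  · refine ⟨1, one_ne_zero, ?_⟩
    rintro a rfl
    rw [distProd, Finset.prod_comm, Int.cast_prod, one_mul]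
    exact Finset.prod_congr rfl fun u hu => prod_sideDents_of_lt h (fernDents_subset hu)
  · refine ⟨(∏ u ∈ fernInterval X Y A, dentWeight Y Z u)⁻¹,
      inv_ne_zero (Finset.prod_pos fun u _ => dentWeight_pos u).ne', ?_⟩
    rintro a rfl
    have hne : ∏ u ∈ fernInterval X Y a.sum, dentWeight Y Z u ≠ 0 :=
      (Finset.prod_pos fun u _ => dentWeight_pos u).ne'
    have hsub : fernDents X Y a ⊆ fernInterval X Y a.sum := fernDents_subset
    have h1 : ∏ u ∈ fernDents X Y a, dentWeight Y Z (axisReflect X Y a.sum u) =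
        ∏ u ∈ fernInterval X Y a.sum \ fernDents X Y a, dentWeight Y Z u := by
      rw [← image_axisReflect_fernDents,
        Finset.prod_image fun _ _ _ _ h => (axisReflect_involutive X Y a.sum).injective h]
    rw [distProd, Finset.prod_comm, Int.cast_prod,
      Finset.prod_congr rfl fun u hu => prod_sideDents_of_le h (hsub hu), Finset.prod_inv_distrib,
      h1]
    have h2 := Finset.prod_sdiff (f := dentWeight Y Z) hsub
    have hne' : ∏ u ∈ fernInterval X Y a.sum \ fernDents X Y a, dentWeight Y Z u ≠ 0 :=
      (Finset.prod_pos fun u _ => dentWeight_pos u).ne'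
    rw [← h2] at hne ⊢
    have hne2 := right_ne_zero_of_mul hne
    field_simp

/-- The quotient of hyperfactorials whose increments are the dent weights. -/
noncomputable def hyperQuotient (X Y Z t : ℕ) : ℝ :=
  (hyperfactorial (X + Y + t) : ℝ) / (hyperfactorial (X + Z + t) : ℝ)

theorem hyperQuotient_pos (X Y Z t : ℕ) : 0 < hyperQuotient X Y Z t :=
  div_pos (by exact_mod_cast hyperfactorial_pos _) (by exact_mod_cast hyperfactorial_pos _)

/-- Telescoping, since consecutive hyperfactorials differ by a factorial. -/
theorem prod_dentWeight_Ico (X Y Z t m : ℕ) :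
    (∏ u ∈ Finset.Ico (X + Y + t : ℤ) (X + Y + t + m), dentWeight Y Z u) * hyperQuotient X Y Z t =
      hyperQuotient X Y Z (t + m) := by
  induction m with
  | zero => simp
  | succ m ih =>
    have h1 : Finset.Ico (X + Y + t : ℤ) (X + Y + t + (m + 1 : ℕ)) =
        insert (X + Y + t + m : ℤ) (Finset.Ico (X + Y + t : ℤ) (X + Y + t + m)) := by
      ext i; simp only [Finset.mem_Ico, Finset.mem_insert]; omega
    rw [h1, Finset.prod_insert (by simp), mul_assoc, ih, dentWeight, hyperQuotient, hyperQuotient,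
      show (X + Y + t + m : ℤ).toNat = X + Y + (t + m) by omega,
      show (X + Y + t + m + Z - Y : ℤ).toNat = X + Z + (t + m) by omega, ← add_assoc t m 1,
      ← add_assoc (X + Y) (t + m) 1, ← add_assoc (X + Z) (t + m) 1, hyperfactorial_succ,
      hyperfactorial_succ]
    push_cast
    rw [div_mul_div_comm, mul_comm, mul_comm (Nat.cast (Nat.factorial (X + Z + (t + m))))]

/-- Each up-pointing lobe spans the segment between an even partial sum and the next one, and the
weights telescope along it. The offset `t` allows induction by two lobes at a time. -/
theorem prod_dentWeight_upSet (X Y Z k t : ℕ) (l : List ℕ) (hl : l.length = 2 * k) :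
    ∏ u ∈ upSet true l (X + Y + t), dentWeight Y Z u =
      ∏ i ∈ Finset.range k, hyperQuotient X Y Z (t + partialSum l (2 * i + 1)) /
        hyperQuotient X Y Z (t + partialSum l (2 * i)) := by
  induction k generalizing l t with
  | zero =>
    obtain rfl := List.length_eq_zero_iff.1 hl
    simp [upSet]
  | succ k ih =>
    match l, hl with
    | m :: n :: l, hl =>
      have hl' : l.length = 2 * k := by simp at hl; omega
      simp only [upSet]
      rw [Finset.prod_union, Finset.prod_range_succ', mul_comm]
      · congr 1
        · have := ih (t + m + n) l hl'
          push_cast at this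
          rw [← add_assoc, ← add_assoc] at this
          rw [this]
          refine Finset.prod_congr rfl fun i _ => ?_
          have h1 : ∀ j, partialSum (m :: n :: l) (j + 2) = m + n + partialSum l j := by
            intro j; simp [partialSum, add_assoc]
          rw [show 2 * (i + 1) + 1 = (2 * i + 1) + 2 by ring, show 2 * (i + 1) = 2 * i + 2 by ring,
            h1, h1]
          simp only [add_assoc]
        · rw [eq_div_iff (hyperQuotient_pos _ _ _ _).ne']
          have := prod_dentWeight_Ico X Y Z t m
          simpa [partialSum] using this
      · refine Finset.disjoint_left.2 fun i hi hi' => ?_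
        have := Finset.mem_Ico.1 (upSet_subset _ _ _ hi')
        rw [Finset.mem_Ico] at hi
        omega

theorem fernDents_singleton (X Y A : ℕ) : fernDents X Y [A] = Finset.Ico (X + Y : ℤ) (X + Y + A) := by
  simp [fernDents, upSet]

theorem fernWeight_div (X Y Z : ℕ) {a : List ℕ} (ha : a ≠ []) :
    (fernWeight X Y Z a : ℝ) / (fernWeight X Y Z [a.sum] : ℝ) =
      (s (a ++ a.reverse) : ℝ) *
        ((hyperfactorial (X + Z + a.sum) : ℝ) / (hyperfactorial (X + Y + a.sum) : ℝ)) *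
        (∏ i ∈ Finset.range a.length,
          ((hyperfactorial (X + Y + partialSum (a ++ a.reverse) (2 * i + 1)) : ℝ) /
            (hyperfactorial (X + Z + partialSum (a ++ a.reverse) (2 * i + 1)) : ℝ))) *
        (∏ i ∈ Finset.Ico 1 a.length,
          ((hyperfactorial (X + Z + partialSum (a ++ a.reverse) (2 * i)) : ℝ) /
            (hyperfactorial (X + Y + partialSum (a ++ a.reverse) (2 * i)) : ℝ))) := by
  obtain ⟨C, hC, hprod⟩ := distProd_sideDents X Y Z a.sum
  have hs : [a.sum].sum = a.sum := by simp
  have h1 : (vand (fernDents X Y a) : ℝ) = s (a ++ a.reverse) * hyperfactorial a.sum := by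
    exact_mod_cast (s_mul_hyperfactorial X Y a).symm
  have h2 : (vand (fernDents X Y [a.sum]) : ℝ) = hyperfactorial a.sum := by
    rw [fernDents_singleton, vand_Ico]; simp
  have h3 : ∏ u ∈ fernDents X Y [a.sum], dentWeight Y Z u =
      hyperQuotient X Y Z a.sum / hyperQuotient X Y Z 0 := by
    have := prod_dentWeight_Ico X Y Z 0 a.sum
    rw [Nat.cast_zero, add_zero, zero_add] at this
    rw [fernDents_singleton, eq_div_iff (hyperQuotient_pos _ _ _ _).ne', this]
  have h4 : ∏ u ∈ fernDents X Y a, dentWeight Y Z u =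
      (∏ i ∈ Finset.range a.length, hyperQuotient X Y Z (partialSum (a ++ a.reverse) (2 * i + 1))) *
      ((hyperQuotient X Y Z 0)⁻¹ * ∏ i ∈ Finset.Ico 1 a.length,
        (hyperQuotient X Y Z (partialSum (a ++ a.reverse) (2 * i)))⁻¹) := by
    have := prod_dentWeight_upSet X Y Z a.length 0 (a ++ a.reverse) (by simp; ring)
    rw [Nat.cast_zero, add_zero] at this
    rw [fernDents, this, Finset.prod_div_distrib]
    simp only [zero_add, div_eq_mul_inv]
    congr 1
    -- The factor with `i = 0` has partial sum 0. It is split off because it cancels against the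
    -- same factor of the fern with two equal lobes.
    rw [← Finset.prod_inv_distrib, Finset.range_eq_Ico,
      Finset.prod_eq_prod_Ico_succ_bot (List.length_pos_iff.2 ha)]
    simp [partialSum]
  have h5 : ∀ t, (hyperfactorial (X + Z + t) : ℝ) / (hyperfactorial (X + Y + t) : ℝ) =
      (hyperQuotient X Y Z t)⁻¹ := fun t => by rw [hyperQuotient, inv_div]
  have h6 : ∀ t, (hyperfactorial (X + Y + t) : ℝ) / (hyperfactorial (X + Z + t) : ℝ) =
      hyperQuotient X Y Z t := fun t => rfl
  simp only [h5, h6]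
  rw [fernWeight, fernWeight, hs]
  push_cast
  rw [hprod a rfl, hprod [a.sum] hs, h1, h2, h3, h4]
  have h7 : (hyperfactorial a.sum : ℝ) ≠ 0 := by exact_mod_cast (hyperfactorial_pos _).ne'
  have h8 := (hyperQuotient_pos X Y Z 0).ne'
  have h9 := (hyperQuotient_pos X Y Z a.sum).ne'
  field_simp

end weights

end FernTilings

theorem theorem1 (x y z : ℕ) (hx : Even x) (hy : Even y) (hz : Even z)
    (a : List ℕ) (ha : a ≠ []) :
    0 < numCentrallySymmetricTilingsFC x y z [a.sum, a.sum] ∧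
    0 < numTilings (fernCoredHexagon x y z [a.sum, a.sum]) ∧
    (numCentrallySymmetricTilingsFC x y z (a ++ a.reverse) : ℝ) /
        (numCentrallySymmetricTilingsFC x y z [a.sum, a.sum] : ℝ) =
      Real.sqrt ((numTilings (fernCoredHexagon x y z (a ++ a.reverse)) : ℝ) /
        (numTilings (fernCoredHexagon x y z [a.sum, a.sum]) : ℝ)) ∧
    (numCentrallySymmetricTilingsFC x y z (a ++ a.reverse) : ℝ) /
        (numCentrallySymmetricTilingsFC x y z [a.sum, a.sum] : ℝ) =
      (s (a ++ a.reverse) : ℝ) *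
        ((hyperfactorial ((x + z) / 2 + a.sum) : ℝ) /
          (hyperfactorial ((x + y) / 2 + a.sum) : ℝ)) *
        (∏ i ∈ Finset.range a.length,
          ((hyperfactorial ((x + y) / 2 + partialSum (a ++ a.reverse) (2 * i + 1)) : ℝ) /
            (hyperfactorial ((x + z) / 2 + partialSum (a ++ a.reverse) (2 * i + 1)) : ℝ))) *
        (∏ i ∈ Finset.Ico 1 a.length,
          ((hyperfactorial ((x + z) / 2 + partialSum (a ++ a.reverse) (2 * i)) : ℝ) /
            (hyperfactorial ((x + y) / 2 + partialSum (a ++ a.reverse) (2 * i)) : ℝ))) := by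
  obtain ⟨X, rfl⟩ := hx.two_dvd
  obtain ⟨Y, rfl⟩ := hy.two_dvd
  obtain ⟨Z, rfl⟩ := hz.two_dvd
  rw [show (2 * X + 2 * Z) / 2 = X + Z by omega, show (2 * X + 2 * Y) / 2 = X + Y by omega]
  have hs : [a.sum].sum = a.sum := by simp
  have e1 := numCentrallySymmetricTilingsFC_eq (X := X) (Y := Y) (Z := Z) (a := a)
  have e2 := numCentrallySymmetricTilingsFC_eq (X := X) (Y := Y) (Z := Z) (a := [a.sum])
  have e3 := numTilings_fernCoredHexagon_eq (X := X) (Y := Y) (Z := Z) (a := a)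
  have e4 := numTilings_fernCoredHexagon_eq (X := X) (Y := Y) (Z := Z) (a := [a.sum])
  rw [hs] at e2 e4
  -- The reference fern is the palindrome of the one-term list `[a.sum]`, so the general formulas
  -- apply to it with the same shape-free sums.
  change (numCentrallySymmetricTilingsFC _ _ _ [a.sum, a.sum] : ℝ) * _ = _ at e2
  change (numTilings (fernCoredHexagon _ _ _ [a.sum, a.sum]) : ℝ) * _ = _ at e4
  have hH : (0 : ℝ) < hyperfactorial (Y + Z + a.sum) := by exact_mod_cast hyperfactorial_pos _
  have hw : (0 : ℝ) < fernWeight X Y Z a := by exact_mod_cast fernWeight_pos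
  have hw' : (0 : ℝ) < fernWeight X Y Z [a.sum] := by exact_mod_cast fernWeight_pos
  have hK := symmetricWeight_pos X Y Z a.sum
  have hL := totalWeight_pos X Y Z a.sum
  have r1 := eq_div_of_mul_eq hH.ne' e1
  have r2 := eq_div_of_mul_eq hH.ne' e2
  have r3 := eq_div_of_mul_eq (pow_pos hH 2).ne' e3
  have r4 := eq_div_of_mul_eq (pow_pos hH 2).ne' e4
  have hratio : (numCentrallySymmetricTilingsFC (2 * X) (2 * Y) (2 * Z) (a ++ a.reverse) : ℝ) /
      (numCentrallySymmetricTilingsFC (2 * X) (2 * Y) (2 * Z) [a.sum, a.sum] : ℝ) =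
      fernWeight X Y Z a / fernWeight X Y Z [a.sum] := by
    rw [r1, r2]
    field_simp
  have hratio' : (numTilings (fernCoredHexagon (2 * X) (2 * Y) (2 * Z) (a ++ a.reverse)) : ℝ) /
      (numTilings (fernCoredHexagon (2 * X) (2 * Y) (2 * Z) [a.sum, a.sum]) : ℝ) =
      (fernWeight X Y Z a / fernWeight X Y Z [a.sum]) ^ 2 := by
    rw [r3, r4]
    field_simp
  refine ⟨?_, ?_, ?_, ?_⟩
  · have : (0 : ℝ) < numCentrallySymmetricTilingsFC (2 * X) (2 * Y) (2 * Z) [a.sum, a.sum] := by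
      rw [r2]; positivity
    exact_mod_cast this
  · have : (0 : ℝ) < numTilings (fernCoredHexagon (2 * X) (2 * Y) (2 * Z) [a.sum, a.sum]) := by
      rw [r4]; positivity
    exact_mod_cast this
  · rw [hratio, hratio', Real.sqrt_sq (div_pos hw hw').le]
  · rw [hratio, fernWeight_div X Y Z ha]
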